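/- **Bi-FEAST Rayleigh–Ritz convergence.** Let $A,B\in\mathbb C^{n\times n}$ with $B$ invertible and $B^{-1}A$ diagonalizable: $AX=BX\Lambda$, $\Lambda=\operatorname{diag}(\lambda_1,\dots,\lambda_n)$, $Y^HBX=I$, with $x_j,y_j$ the columns of $X,Y$. Let $\rho(\mu)=\sum_{l=1}^q\alpha_l/(\beta_l-\mu)$ be a rational function none of whose $\beta_l$ is an eigenvalue $\lambda_j$, put $\rho(B^{-1}A)=\sum_l\alpha_l(\beta_lI-B^{-1}A)^{-1}$ and $\gamma_j=\rho(\lambda_j)$, and number the eigenvalues so that $|\gamma_1|\ge\dots\ge|\gamma_n|$. Let $1\le m'\le p<n$ with $|\gamma_{m'+1}|<|\gamma_{m'}|$ and $|\gamma_{p+1}|<|\gamma_p|$, and put $\varepsilon=|\gamma_{p+1}/\gamma_{m'}|$ and $\Lambda_{m'}=\operatorname{diag}(\lambda_1,\dots,\lambda_{m'})$. Let $U_{(0)},V_{(0)}\in\mathbb C^{n\times p}$ satisfy $V_{(0)}^HBU_{(0)}=I_p$, with $[y_1,\dots,y_p]^HBU_{(0)}$ and $V_{(0)}^HB[x_1,\dots,x_p]$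 nonsingular. Consider the Bi-FEAST iteration in exact arithmetic: for $k=1,2,\dots$ set $\widehat U=\rho(B^{-1}A)U_{(k-1)}$, $\widehat V=B^{-H}\rho(B^{-1}A)^HB^HV_{(k-1)}$, $\widehat A=\widehat V^HA\widehat U$, $\widehat B=\widehat V^HB\widehat U$; solve the reduced eigenproblem $\widehat A=\widehat BW\widehat\Lambda_{(k)}Z^H\widehat B$, $Z^H\widehat BW=I_p$, with $\widehat\Lambda_{(k)}$ diagonal (assumed solvable in every step, for an arbitrary choice of the solution); set $U_{(k)}=\widehat UW$, $V_{(k)}=\widehat VZ$. Then there is a constant $C$, independent of $k$ and of the choices of $W,Z,\widehat\Lambda_{(k)}$, such that for every $k\ge1$ (with $\|\cdot\|$ the Euclidean and the induced operator norm): 1. $\widehat B^{-1}\widehat A$ is similar to, and so has the same eigenvalues as, a block matrix $\begin{bmatrix}A'_{11}&A'_{12}\\A'_{21}&A'_{22}\end{bmatrix}$ with $A'_{11}\in\mathbb C^{m'\times m'}$, $\|A'_{11}-\Lambda_{m'}\|\le C\varepsilon^{2k}$, $\|A'_{21}\|\le C\varepsilon^k$ and $\|A'_{12}\|\le C\varepsilon^k$.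 2. There are $m'$ distinct positions on the diagonal of $\widehat\Lambda_{(k)}$, with entries $\hat\lambda_1,\dots,\hat\lambda_{m'}$ and corresponding columns $u_j$ of $U_{(k)}$ and $v_j$ of $V_{(k)}$, such that for $j=1,\dots,m'$ $$|\hat\lambda_j-\lambda_j|\le C\varepsilon^{2k},\qquad \|(A-\hat\lambda_jB)u_j\|\le C\varepsilon^k\|u_j\|,\qquad \|(A-\hat\lambda_jB)^Hv_j\|\le C\varepsilon^k\|v_j\|.$$ -/

import Mathlib

open Matrix
open scoped Matrix.Norms.L2Operator

noncomputable section

namespace BiFEAST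

/-- The rational function `ρ(μ) = ∑ₗ αₗ / (βₗ - μ)` in partial fraction form. -/
def rho {q : ℕ} (α β : Fin q → ℂ) (μ : ℂ) : ℂ :=
  ∑ l, α l / (β l - μ)

/-- The same rational function applied to a matrix: `ρ(M) = ∑ₗ αₗ (βₗ I - M)⁻¹`. -/
def rhoMat {n q : ℕ} (α β : Fin q → ℂ) (M : Matrix (Fin n) (Fin n) ℂ) :
    Matrix (Fin n) (Fin n) ℂ :=
  ∑ l, α l • (β l • (1 : Matrix (Fin n) (Fin n) ℂ) - M)⁻¹

/-- The approximate right spectral projector `ρ(B⁻¹A)`. -/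
def rightProj {n q : ℕ} (α β : Fin q → ℂ) (A B : Matrix (Fin n) (Fin n) ℂ) :
    Matrix (Fin n) (Fin n) ℂ :=
  rhoMat α β (B⁻¹ * A)

/-- The approximate left spectral projector `B⁻ᴴ ρ(B⁻¹A)ᴴ Bᴴ`. -/
def leftProj {n q : ℕ} (α β : Fin q → ℂ) (A B : Matrix (Fin n) (Fin n) ℂ) :
    Matrix (Fin n) (Fin n) ℂ :=
  (Bᴴ)⁻¹ * (rhoMat α β (B⁻¹ * A))ᴴ * Bᴴ

/-- The first `p` columns of an `n × n` matrix. -/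
def firstCols {n p : ℕ} (hp : p ≤ n) (X : Matrix (Fin n) (Fin n) ℂ) :
    Matrix (Fin n) (Fin p) ℂ :=
  X.submatrix id (Fin.castLE hp)

/-- The Euclidean norm of a complex vector. -/
def enorm2 {n : ℕ} (v : Fin n → ℂ) : ℝ := ‖WithLp.toLp 2 v‖

/-- The reduced matrix `V̂ᴴ S Û` (with `S = A` or `S = B`) formed from the iterates `U`, `V`,
where `Û = ρ(B⁻¹A) U` and `V̂ = B⁻ᴴ ρ(B⁻¹A)ᴴ Bᴴ V`. -/
def reduced {n p q : ℕ} (α β : Fin q → ℂ) (A B S : Matrix (Fin n) (Fin n) ℂ)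
    (U V : Matrix (Fin n) (Fin p) ℂ) : Matrix (Fin p) (Fin p) ℂ :=
  (leftProj α β A B * V)ᴴ * S * (rightProj α β A B * U)

/-- An (infinite) run of the iteration Bi-FEAST in exact arithmetic, started at `U₀`, `V₀`.
`U k`, `V k` are the iterates after `k` steps; `W k`, `Z k`, `ritz k` are the outcome of the
reduced eigenproblem solved in step `k ≥ 1` (the values at `k = 0` are irrelevant).
The reduced problem `Â = B̂ W Λ̂ Zᴴ B̂` is solved by an eigendecomposition, that is, with
bi-orthogonal left and right eigenvectors, `Zᴴ B̂ W = I`. -/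
structure IsRun {n p q : ℕ} (α β : Fin q → ℂ) (A B : Matrix (Fin n) (Fin n) ℂ)
    (U₀ V₀ : Matrix (Fin n) (Fin p) ℂ)
    (U V : ℕ → Matrix (Fin n) (Fin p) ℂ) (W Z : ℕ → Matrix (Fin p) (Fin p) ℂ)
    (ritz : ℕ → Fin p → ℂ) : Prop where
  initU : U 0 = U₀
  initV : V 0 = V₀
  solve : ∀ k, reduced α β A B A (U k) (V k) =
    reduced α β A B B (U k) (V k) * W (k + 1) * diagonal (ritz (k + 1)) * (Z (k + 1))ᴴ
      * reduced α β A B B (U k) (V k)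
  biorth : ∀ k, (Z (k + 1))ᴴ * reduced α β A B B (U k) (V k) * W (k + 1) = 1
  stepU : ∀ k, U (k + 1) = rightProj α β A B * U k * W (k + 1)
  stepV : ∀ k, V (k + 1) = leftProj α β A B * V k * Z (k + 1)

end BiFEAST

end

/-!
In the coordinates given by the eigenvectors, one step of the iteration multiplies the `j`-th
coordinate by `ρ(λⱼ)`. The span of `U k` is therefore the graph, over the first `p` coordinates, of
a matrix `M = Γ₂ᵏ E Γ₁⁻ᵏ`, whose columns are `O(εᵏ)` for the wanted eigenvalues and still tend
to `0` for the other ones; the changes of basis `W k` do not affect it. The same holds for `V k`,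
with a matrix `N` in place of `M`, because the left problem is the right problem of `(Aᴴ, Bᴴ)`. In
graph coordinates the reduced pencil is `(Λ₁ + Nᴴ Λ₂ M, 1 + Nᴴ M)`, so that the wanted block is
perturbed by a product of two small matrices, which is `O(ε²ᵏ)`, and the off-diagonal blocks by
`O(εᵏ)`.
-/

namespace BiFEAST

open Filter Topology

local notation "‖" v "‖₂" => ‖WithLp.toLp 2 v‖

section Norms

variable {𝕜 ι κ μ : Type*} [RCLike 𝕜] [Fintype ι] [Fintype κ] [Fintype μ]

lemma l2_norm_mulVec_le [DecidableEq κ] (M : Matrix ι κ 𝕜) (v : κ → 𝕜) :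
    ‖M *ᵥ v‖₂ ≤ ‖M‖ * ‖v‖₂ :=
  M.l2_opNorm_mulVec (WithLp.toLp 2 v)

lemma l2_opNorm_le_of_mulVec_le [DecidableEq κ] {M : Matrix ι κ 𝕜} {R : ℝ} (hR : 0 ≤ R)
    (h : ∀ v, ‖M *ᵥ v‖₂ ≤ R * ‖v‖₂) : ‖M‖ ≤ R := by
  rw [l2_opNorm_def]
  exact ContinuousLinearMap.opNorm_le_bound _ hR fun x => h x.ofLp

lemma l2_norm_comp_le {f : κ → ι} (hf : Function.Injective f) (v : ι → 𝕜) :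
    ‖v ∘ f‖₂ ≤ ‖v‖₂ := by
  refine (sq_le_sq₀ (norm_nonneg _) (norm_nonneg _)).mp ?_
  simp only [EuclideanSpace.norm_sq_eq, Function.comp_apply]
  calc ∑ k, ‖v (f k)‖ ^ 2 = ∑ i ∈ Finset.univ.map ⟨f, hf⟩, ‖v i‖ ^ 2 := by simp
    _ ≤ ∑ i, ‖v i‖ ^ 2 := Finset.sum_le_univ_sum_of_nonneg fun i => by positivity

lemma mul_l2_norm_le_diagonal_mulVec [DecidableEq ι] {d : ι → 𝕜} {r : ℝ} (hr : 0 ≤ r)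
    (hd : ∀ i, r ≤ ‖d i‖) (v : ι → 𝕜) : r * ‖v‖₂ ≤ ‖diagonal d *ᵥ v‖₂ := by
  refine (sq_le_sq₀ (by positivity) (norm_nonneg _)).mp ?_
  simp only [mul_pow, EuclideanSpace.norm_sq_eq, mulVec_diagonal, norm_mul, Finset.mul_sum]
  gcongr with i
  exact hd i

lemma l2_opNorm_diagonal_le [DecidableEq ι] {d : ι → 𝕜} {R : ℝ} (hR : 0 ≤ R)
    (hd : ∀ i, ‖d i‖ ≤ R) : ‖diagonal d‖ ≤ R := by
  rwa [l2_opNorm_diagonal, pi_norm_le_iff_of_nonneg hR]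

lemma l2_norm_diagonal_mulVec_le [DecidableEq ι] {d : ι → 𝕜} {R : ℝ} (hR : 0 ≤ R)
    (hd : ∀ i, ‖d i‖ ≤ R) (v : ι → 𝕜) : ‖diagonal d *ᵥ v‖₂ ≤ R * ‖v‖₂ :=
  (l2_norm_mulVec_le _ _).trans
    (mul_le_mul_of_nonneg_right (l2_opNorm_diagonal_le hR hd) (norm_nonneg _))

lemma l2_opNorm_one_le [DecidableEq ι] : ‖(1 : Matrix ι ι 𝕜)‖ ≤ 1 := by
  rw [← diagonal_one]
  exact l2_opNorm_diagonal_le zero_le_one (by simp)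

lemma l2_opNorm_fromCols_le [DecidableEq κ] [DecidableEq μ] (M : Matrix ι κ 𝕜)
    (N : Matrix ι μ 𝕜) : ‖fromCols M N‖ ≤ ‖M‖ + ‖N‖ := by
  refine l2_opNorm_le_of_mulVec_le (by positivity) fun v => ?_
  calc ‖fromCols M N *ᵥ v‖₂ ≤ ‖M *ᵥ (v ∘ Sum.inl)‖₂ + ‖N *ᵥ (v ∘ Sum.inr)‖₂ := by
        rw [fromCols_mulVec]
        exact norm_add_le (WithLp.toLp 2 _) (WithLp.toLp 2 _)
    _ ≤ ‖M‖ * ‖v ∘ Sum.inl‖₂ + ‖N‖ * ‖v ∘ Sum.inr‖₂ :=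
        add_le_add (l2_norm_mulVec_le _ _) (l2_norm_mulVec_le _ _)
    _ ≤ (‖M‖ + ‖N‖) * ‖v‖₂ := by
        rw [add_mul]
        gcongr
        exacts [l2_norm_comp_le Sum.inl_injective v, l2_norm_comp_le Sum.inr_injective v]

lemma l2_opNorm_fromRows_le [DecidableEq ι] (M : Matrix κ ι 𝕜) (N : Matrix μ ι 𝕜) :
    ‖fromRows M N‖ ≤ ‖M‖ + ‖N‖ := by
  classical
  rw [← l2_opNorm_conjTranspose, conjTranspose_fromRows_eq_fromCols_conjTranspose,
    ← l2_opNorm_conjTranspose M, ← l2_opNorm_conjTranspose N]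
  exact l2_opNorm_fromCols_le _ _

lemma l2_opNorm_mul_mul_le [DecidableEq κ] [DecidableEq μ] {ν : Type*} [Fintype ν]
    [DecidableEq ν] (L : Matrix ι κ 𝕜) (M : Matrix κ μ 𝕜) (N : Matrix μ ν 𝕜) :
    ‖L * M * N‖ ≤ ‖L‖ * ‖M‖ * ‖N‖ :=
  (l2_opNorm_mul _ _).trans (mul_le_mul_of_nonneg_right (l2_opNorm_mul _ _) (norm_nonneg _))

lemma isUnit_one_add_of_l2_opNorm_le_half [DecidableEq ι] {E : Matrix ι ι 𝕜}
    (hE : ‖E‖ ≤ 1 / 2) : IsUnit (1 + E) := by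
  rw [← sub_neg_eq_add]
  exact isUnit_one_sub_of_norm_lt_one (by rw [norm_neg]; linarith)

lemma l2_opNorm_inv_one_add_le_two [DecidableEq ι] {E : Matrix ι ι 𝕜}
    (hE : ‖E‖ ≤ 1 / 2) : ‖(1 + E)⁻¹‖ ≤ 2 := by
  set S := (1 + E)⁻¹
  have hS : S = 1 - S * E := by
    have hinv : S * (1 + E) = 1 :=
      nonsing_inv_mul _ ((isUnit_iff_isUnit_det _).mp (isUnit_one_add_of_l2_opNorm_le_half hE))
    rw [mul_add, mul_one] at hinv
    exact eq_sub_of_add_eq hinv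
  have hle : ‖S‖ ≤ 1 + ‖S‖ * (1 / 2) := calc
    ‖S‖ ≤ ‖(1 : Matrix ι ι 𝕜)‖ + ‖S * E‖ := (congrArg norm hS).trans_le (norm_sub_le _ _)
    _ ≤ 1 + ‖S‖ * (1 / 2) := by
      gcongr
      · exact l2_opNorm_one_le
      · exact (l2_opNorm_mul _ _).trans (mul_le_mul_of_nonneg_left hE (norm_nonneg _))
  linarith

end Norms

lemma col_mul {R μ ν κ : Type*} [NonUnitalNonAssocSemiring R] [Fintype ν] (M : Matrix μ ν R)
    (N : Matrix ν κ R) (j : κ) : (M * N).col j = M *ᵥ N.col j :=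
  rfl

section Invertible

variable {𝕜 ι κ μ : Type*} [Field 𝕜] [Fintype ι] [Fintype κ] [Fintype μ]
  [DecidableEq ι] [DecidableEq κ] [DecidableEq μ]

/-- Invertibility of a matrix whose rows and columns are indexed by different types, as happens
for changes of basis between differently labelled bases. -/
def IsInvertible (S : Matrix ι κ 𝕜) : Prop :=
  ∃ S' : Matrix κ ι 𝕜, S * S' = 1 ∧ S' * S = 1

lemma isInvertible_iff_isUnit {S : Matrix ι ι 𝕜} : IsInvertible S ↔ IsUnit S :=
  isUnit_iff_exists.symm

namespace IsInvertible

lemma mul {S : Matrix ι κ 𝕜} {T : Matrix κ μ 𝕜} (hS : IsInvertible S) (hT : IsInvertible T) :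
    IsInvertible (S * T) := by
  obtain ⟨S', hSS', hS'S⟩ := hS
  obtain ⟨T', hTT', hT'T⟩ := hT
  refine ⟨T' * S', ?_, ?_⟩
  · rw [← Matrix.mul_assoc, Matrix.mul_assoc S, hTT', Matrix.mul_one, hSS']
  · rw [← Matrix.mul_assoc, Matrix.mul_assoc T', hS'S, Matrix.mul_one, hT'T]

lemma conjTranspose [StarRing 𝕜] {S : Matrix ι κ 𝕜} (hS : IsInvertible S) :
    IsInvertible Sᴴ := by
  obtain ⟨S', hSS', hS'S⟩ := hS
  exact ⟨S'ᴴ, by rw [← conjTranspose_mul, hS'S, conjTranspose_one],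
    by rw [← conjTranspose_mul, hSS', conjTranspose_one]⟩

lemma submatrix {S : Matrix ι ι 𝕜} (hS : IsInvertible S) (e : κ ≃ ι) :
    IsInvertible (S.submatrix e id) := by
  obtain ⟨S', hSS', hS'S⟩ := hS
  refine ⟨S'.submatrix id e, ?_, ?_⟩
  · rw [← submatrix_mul _ _ _ _ _ Function.bijective_id, hSS', submatrix_one_equiv]
  · rw [submatrix_mul_equiv S' S id e id, hS'S, submatrix_id_id]

lemma col_ne_zero {S : Matrix ι κ 𝕜} (hS : IsInvertible S) (k : κ) : S.col k ≠ 0 := by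
  obtain ⟨S', -, hS'S⟩ := hS
  intro h
  have hcol := col_mul S' S k
  rw [hS'S, h, mulVec_zero] at hcol
  simpa using congrFun hcol k

lemma nonempty_equiv {S : Matrix ι κ 𝕜} (hS : IsInvertible S) : Nonempty (ι ≃ κ) := by
  obtain ⟨S', hSS', hS'S⟩ := hS
  exact Fintype.card_eq.mp (square_of_invertible S S' hSS' hS'S)

end IsInvertible

end Invertible

lemma exists_equiv_of_prod_sub_eq {K ι κ : Type*} [Field K] [Infinite K] [Fintype ι] [Fintype κ]
    {r : κ → K} {l : ι → K} (h : ∀ z, ∏ k, (z - r k) = ∏ i, (z - l i)) :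
    ∃ σ : ι ≃ κ, ∀ i, r (σ i) = l i := by
  classical
  have hpoly : ((Finset.univ.val.map r).map fun x => Polynomial.X - Polynomial.C x).prod =
      ((Finset.univ.val.map l).map fun x => Polynomial.X - Polynomial.C x).prod := by
    simp only [Multiset.map_map]
    exact Polynomial.funext fun z => by simpa [Polynomial.eval_prod] using h z
  have hval : Finset.univ.val.map r = Finset.univ.val.map l := by
    rw [← Polynomial.roots_multiset_prod_X_sub_C (Finset.univ.val.map r), hpoly,
      Polynomial.roots_multiset_prod_X_sub_C]
  have hfiber (z : K) : Nonempty ({i // l i = z} ≃ {k // r k = z}) := by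
    have hcount := congrArg (Multiset.count z) hval
    rw [Multiset.count_map, Multiset.count_map] at hcount
    rw [← Fintype.card_eq, Fintype.card_subtype, Fintype.card_subtype]
    simpa only [Finset.card_def, Finset.filter_val, eq_comm] using hcount.symm
  exact ⟨Equiv.ofFiberEquiv fun z => (hfiber z).some,
    fun i => Equiv.ofFiberEquiv_map (fun z => (hfiber z).some) i⟩

section Diagonalization

variable {𝕜 ι κ : Type*} [RCLike 𝕜] [Fintype ι] [Fintype κ] [DecidableEq ι] [DecidableEq κ]

lemma norm_eigenvalue_le_of_diagonalization {A : Matrix ι ι 𝕜} {G : Matrix ι κ 𝕜} {r : κ → 𝕜}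
    (hG : IsInvertible G) (h : A * G = G * diagonal r) (k : κ) : ‖r k‖ ≤ ‖A‖ := by
  have heig : A *ᵥ G.col k = r k • G.col k := by
    rw [← col_mul, h]
    ext i
    rw [col_apply, mul_diagonal, Pi.smul_apply, col_apply, smul_eq_mul, mul_comm]
  have hpos : 0 < ‖G.col k‖₂ := by simpa using hG.col_ne_zero k
  have hle := l2_norm_mulVec_le A (G.col k)
  rw [heig, WithLp.toLp_smul, norm_smul] at hle
  exact le_of_mul_le_mul_right hle hpos

lemma det_sub_eq_prod_of_diagonalization {A : Matrix ι ι 𝕜} {G : Matrix ι κ 𝕜} {r : κ → 𝕜}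
    (hG : IsInvertible G) (h : A * G = G * diagonal r) (z : 𝕜) :
    (z • (1 : Matrix ι ι 𝕜) - A).det = ∏ k, (z - r k) := by
  obtain ⟨G', hGG', hG'G⟩ := hG
  have hconj : z • (1 : Matrix ι ι 𝕜) - A = G * diagonal (fun k => z - r k) * G' := by
    have hA : A = G * diagonal r * G' := by rw [← h, Matrix.mul_assoc, hGG', Matrix.mul_one]
    have hdiag : diagonal (fun k => z - r k) = z • (1 : Matrix κ κ 𝕜) - diagonal r := by
      rw [smul_one_eq_diagonal, diagonal_sub]
    rw [hdiag, Matrix.mul_sub, Matrix.sub_mul, ← hA, Matrix.mul_smul, Matrix.smul_mul,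
      Matrix.mul_one, hGG']
  rw [hconj, det_conj_of_mul_eq_one hGG' hG'G, det_diagonal]

/-- The space of candidate tuples `r` is compact, so it suffices to separate each `r` that is not
a relabelling of `l` from the spectra of nearby matrices; one value of the characteristic
polynomial does so. -/
lemma eventually_exists_eigenvalue_matching (l : ι → 𝕜) {η : ℝ} (hη : 0 < η) :
    ∀ᶠ A in 𝓝 (diagonal l), ∀ (G : Matrix ι κ 𝕜) (r : κ → 𝕜), IsInvertible G →
      A * G = G * diagonal r → ∃ σ : ι ≃ κ, ∀ i, ‖r (σ i) - l i‖ < η := by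
  have hcompact : ∀ᶠ A in 𝓝 (diagonal l),
      ∀ r ∈ Metric.closedBall (0 : κ → 𝕜) (‖diagonal l‖ + 1),
        (∃ σ : ι ≃ κ, ∀ i, ‖r (σ i) - l i‖ < η) ∨
          ∃ z : 𝕜, (z • (1 : Matrix ι ι 𝕜) - A).det ≠ ∏ k, (z - r k) := by
    refine (isCompact_closedBall _ _).eventually_forall_of_forall_eventually fun r _ => ?_
    by_cases hr : ∃ σ : ι ≃ κ, ∀ i, r (σ i) = l i
    · obtain ⟨σ, hσ⟩ := hr
      have hcont (i : ι) : Continuous fun x : Matrix ι ι 𝕜 × (κ → 𝕜) => ‖x.2 (σ i) - l i‖ := by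
        fun_prop
      refine (eventually_all.mpr fun i => ?_).mono fun x hx => Or.inl ⟨σ, hx⟩
      exact (hcont i).continuousAt.eventually_lt_const (by simpa [hσ] using hη)
    · obtain ⟨z, hz⟩ : ∃ z, ∏ k, (z - r k) ≠ ∏ i, (z - l i) := by
        by_contra! h
        exact hr (exists_equiv_of_prod_sub_eq h)
      have hcont : Continuous fun x : Matrix ι ι 𝕜 × (κ → 𝕜) =>
          (z • (1 : Matrix ι ι 𝕜) - x.1).det - ∏ k, (z - x.2 k) := by fun_prop
      refine (hcont.continuousAt.eventually_ne ?_).mono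
        fun x hx => Or.inr ⟨z, sub_ne_zero.mp hx⟩
      rw [smul_one_eq_diagonal, diagonal_sub, det_diagonal]
      exact sub_ne_zero.mpr hz.symm
  have hnorm : ∀ᶠ A in 𝓝 (diagonal l), ‖A‖ < ‖diagonal l‖ + 1 :=
    continuous_norm.continuousAt.eventually_lt_const (lt_add_one _)
  filter_upwards [hcompact, hnorm] with A hA hAl G r hG hAG
  refine (hA r ?_).resolve_right fun ⟨z, hz⟩ => hz (det_sub_eq_prod_of_diagonalization hG hAG z)
  rw [mem_closedBall_zero_iff, pi_norm_le_iff_of_nonneg (by positivity)]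
  exact fun k => (norm_eigenvalue_le_of_diagonalization hG hAG k).trans hAl.le

end Diagonalization

section Compression

variable {𝕜 ι c : Type*} [RCLike 𝕜] [Fintype ι] [Fintype c] [DecidableEq ι] [DecidableEq c]
  {d ev : ι ⊕ c → 𝕜} {M N : Matrix c ι 𝕜}

/-- The matrix whose columns are the basis `(eᵢ, M eᵢ)` of the graph of `M`. Subspaces close to
the leading coordinate space are graphs of small matrices `M`. -/
def graph (M : Matrix c ι 𝕜) : Matrix (ι ⊕ c) ι 𝕜 :=
  fromRows 1 M

/-- The Petrov–Galerkin compression of the operator `diagonal d` to the trial space `graph M`,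
tested against `graph N`. -/
def compression (d : ι ⊕ c → 𝕜) (M N : Matrix c ι 𝕜) : Matrix ι ι 𝕜 :=
  (graph N)ᴴ * diagonal d * graph M

/-- The matrix `B̂⁻¹Â` of the reduced pencil obtained by compressing the pencil
`(diagonal ev, 1)`. -/
noncomputable def ritzMatrix (ev : ι ⊕ c → 𝕜) (M N : Matrix c ι 𝕜) : Matrix ι ι 𝕜 :=
  (compression 1 M N)⁻¹ * compression ev M N

omit [Fintype c] [DecidableEq c] in
lemma graph_mulVec (M : Matrix c ι 𝕜) (g : ι → 𝕜) : graph M *ᵥ g = Sum.elim g (M *ᵥ g) := by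
  rw [graph, fromRows_mulVec, one_mulVec]

lemma compression_eq (d : ι ⊕ c → 𝕜) (M N : Matrix c ι 𝕜) :
    compression d M N =
      diagonal (d ∘ Sum.inl) + Nᴴ * diagonal (d ∘ Sum.inr) * M := by
  have hd : diagonal d = fromBlocks (diagonal (d ∘ Sum.inl)) 0 0 (diagonal (d ∘ Sum.inr)) := by
    rw [fromBlocks_diagonal, Sum.elim_comp_inl_inr]
  rw [compression, graph, graph, conjTranspose_fromRows_eq_fromCols_conjTranspose, hd,
    fromCols_mul_fromBlocks, fromCols_mul_fromRows]
  simp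

lemma compression_one (M N : Matrix c ι 𝕜) : compression 1 M N = 1 + Nᴴ * M := by
  rw [compression_eq, show (1 : ι ⊕ c → 𝕜) ∘ Sum.inl = 1 from rfl,
    show (1 : ι ⊕ c → 𝕜) ∘ Sum.inr = 1 from rfl, diagonal_one', diagonal_one',
    Matrix.mul_one]

lemma conjTranspose_compression (d : ι ⊕ c → 𝕜) (M N : Matrix c ι 𝕜) :
    (compression d M N)ᴴ = compression (star d) N M := by
  simp only [compression, conjTranspose_mul, conjTranspose_conjTranspose,
    diagonal_conjTranspose, Matrix.mul_assoc]

/-- The push-through identity `(1 + Nᴴ M) Nᴴ = Nᴴ (1 + M Nᴴ)` moves the inverse inwards, so that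
the rows of `Nᴴ` and the columns of the commutator can be estimated separately. -/
lemma ritzMatrix_sub_diagonal (hunit : IsUnit (compression 1 M N)) (ev : ι ⊕ c → 𝕜) :
    ritzMatrix ev M N - diagonal (ev ∘ Sum.inl) =
      Nᴴ * (1 + M * Nᴴ)⁻¹ *
        (diagonal (ev ∘ Sum.inr) * M - M * diagonal (ev ∘ Sum.inl)) := by
  set Λ := diagonal (ev ∘ Sum.inl)
  set Ω := diagonal (ev ∘ Sum.inr)
  have hunit' : IsUnit (1 + M * Nᴴ).det := by
    rwa [← det_one_add_mul_comm, ← isUnit_iff_isUnit_det, ← compression_one]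
  have hpush : (1 + Nᴴ * M) * Nᴴ = Nᴴ * (1 + M * Nᴴ) := by
    rw [Matrix.add_mul, Matrix.mul_add, Matrix.one_mul, Matrix.mul_one, Matrix.mul_assoc]
  rw [compression_one] at hunit
  refine hunit.mul_left_cancel ?_
  calc (1 + Nᴴ * M) * (ritzMatrix ev M N - Λ)
      = Λ + Nᴴ * Ω * M - (1 + Nᴴ * M) * Λ := by
        rw [Matrix.mul_sub, ritzMatrix, compression_one, mul_nonsing_inv_cancel_left _ _
          ((isUnit_iff_isUnit_det _).mp hunit), compression_eq]
    _ = Nᴴ * (Ω * M - M * Λ) := by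
        rw [Matrix.add_mul, Matrix.one_mul, add_sub_add_left_eq_sub, Matrix.mul_sub]
        simp only [Matrix.mul_assoc]
    _ = (1 + Nᴴ * M) * (Nᴴ * (1 + M * Nᴴ)⁻¹ * (Ω * M - M * Λ)) := by
        rw [← Matrix.mul_assoc, ← Matrix.mul_assoc, hpush,
          mul_nonsing_inv_cancel_right _ _ hunit']

lemma l2_opNorm_diagonal_mul_sub_mul_diagonal_le {l : ι → 𝕜} {l' : c → 𝕜} {R : ℝ} (hR : 0 ≤ R)
    (hl : ∀ i, ‖l i‖ ≤ R) (hl' : ∀ j, ‖l' j‖ ≤ R) (M : Matrix c ι 𝕜) :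
    ‖diagonal l' * M - M * diagonal l‖ ≤ 2 * R * ‖M‖ := by
  calc ‖diagonal l' * M - M * diagonal l‖
      ≤ ‖diagonal l'‖ * ‖M‖ + ‖M‖ * ‖diagonal l‖ :=
        (norm_sub_le _ _).trans (add_le_add (l2_opNorm_mul _ _) (l2_opNorm_mul _ _))
    _ ≤ R * ‖M‖ + ‖M‖ * R := by
        gcongr
        exacts [l2_opNorm_diagonal_le hR hl', l2_opNorm_diagonal_le hR hl]
    _ = 2 * R * ‖M‖ := by ring

section SmallCoupling

variable (hMN : ‖M‖ * ‖N‖ ≤ 1 / 2)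

include hMN

lemma isUnit_compression_one : IsUnit (compression 1 M N) := by
  rw [compression_one]
  refine isUnit_one_add_of_l2_opNorm_le_half ((l2_opNorm_mul _ _).trans ?_)
  rwa [l2_opNorm_conjTranspose, mul_comm]

lemma l2_opNorm_conjTranspose_mul_inv_mul_le {κ μ : Type*} [Fintype κ] [Fintype μ]
    [DecidableEq κ] [DecidableEq μ] (L : Matrix c κ 𝕜) (D : Matrix c μ 𝕜) :
    ‖Lᴴ * (1 + M * Nᴴ)⁻¹ * D‖ ≤ 2 * (‖L‖ * ‖D‖) := by
  have hinv : ‖(1 + M * Nᴴ)⁻¹‖ ≤ 2 := l2_opNorm_inv_one_add_le_two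
    ((l2_opNorm_mul _ _).trans (by rwa [l2_opNorm_conjTranspose]))
  calc ‖Lᴴ * (1 + M * Nᴴ)⁻¹ * D‖ ≤ ‖Lᴴ‖ * ‖(1 + M * Nᴴ)⁻¹‖ * ‖D‖ := l2_opNorm_mul_mul_le _ _ _
    _ ≤ ‖L‖ * 2 * ‖D‖ := by rw [l2_opNorm_conjTranspose]; gcongr
    _ = 2 * (‖L‖ * ‖D‖) := by ring

lemma l2_opNorm_ritzMatrix_sub_diagonal_le (ev : ι ⊕ c → 𝕜) :
    ‖ritzMatrix ev M N - diagonal (ev ∘ Sum.inl)‖ ≤ 4 * ‖ev‖ * (‖M‖ * ‖N‖) := by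
  rw [ritzMatrix_sub_diagonal (isUnit_compression_one hMN)]
  calc _ ≤ 2 * (‖N‖ * (2 * ‖ev‖ * ‖M‖)) := by
        refine (l2_opNorm_conjTranspose_mul_inv_mul_le hMN _ _).trans ?_
        gcongr
        exact l2_opNorm_diagonal_mul_sub_mul_diagonal_le (norm_nonneg _)
          (fun i => norm_le_pi_norm ev _) (fun i => norm_le_pi_norm ev _) M
    _ = 4 * ‖ev‖ * (‖M‖ * ‖N‖) := by ring

end SmallCoupling

end Compression

section GradedPerturbation

variable {𝕜 a b c : Type*} [RCLike 𝕜] [Fintype a] [Fintype b] [Fintype c]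
  [DecidableEq a] [DecidableEq b]

/-- Norm bounds `e` and `d` for the columns of `M` belonging to the wanted eigenvalues (`a`) and
to the remaining basis vectors (`b`). In the iteration `e` decays faster than `d`. -/
structure GradedBound (M : Matrix c (a ⊕ b) 𝕜) (e d : ℝ) : Prop where
  cols₁ : ‖M.toCols₁‖ ≤ e
  cols₂ : ‖M.toCols₂‖ ≤ d

namespace GradedBound

variable {M N : Matrix c (a ⊕ b) 𝕜} {e d : ℝ}

lemma nonneg_left (h : GradedBound M e d) : 0 ≤ e := (norm_nonneg _).trans h.cols₁

lemma nonneg_right (h : GradedBound M e d) : 0 ≤ d := (norm_nonneg _).trans h.cols₂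

lemma norm_le (h : GradedBound M e d) : ‖M‖ ≤ e + d := by
  rw [← fromCols_toCols M]
  exact (l2_opNorm_fromCols_le _ _).trans (add_le_add h.cols₁ h.cols₂)

lemma norm_mul_norm_le (hM : GradedBound M e d) (hN : GradedBound N e d) (hed : e ≤ d) :
    ‖M‖ * ‖N‖ ≤ 4 * d ^ 2 := calc
  ‖M‖ * ‖N‖ ≤ (d + d) * (d + d) := by
    have := hM.nonneg_right
    gcongr
    exacts [hM.norm_le.trans (by gcongr), hN.norm_le.trans (by gcongr)]
  _ = 4 * d ^ 2 := by ring

lemma diagonal_mul_sub_mul_diagonal [DecidableEq c] (hM : GradedBound M e d)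
    (ev : (a ⊕ b) ⊕ c → 𝕜) :
    GradedBound (diagonal (ev ∘ Sum.inr) * M - M * diagonal (ev ∘ Sum.inl))
      (2 * ‖ev‖ * e) (2 * ‖ev‖ * d) := by
  constructor
  · have hcols : (diagonal (ev ∘ Sum.inr) * M - M * diagonal (ev ∘ Sum.inl)).toCols₁ =
        diagonal (ev ∘ Sum.inr) * M.toCols₁ - M.toCols₁ * diagonal (ev ∘ Sum.inl ∘ Sum.inl) := by
      ext; simp
    rw [hcols]
    exact (l2_opNorm_diagonal_mul_sub_mul_diagonal_le (norm_nonneg ev)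
      (fun _ => norm_le_pi_norm ev _) (fun _ => norm_le_pi_norm ev _) _).trans
      (by gcongr; exact hM.cols₁)
  · have hcols : (diagonal (ev ∘ Sum.inr) * M - M * diagonal (ev ∘ Sum.inl)).toCols₂ =
        diagonal (ev ∘ Sum.inr) * M.toCols₂ - M.toCols₂ * diagonal (ev ∘ Sum.inl ∘ Sum.inr) := by
      ext; simp
    rw [hcols]
    exact (l2_opNorm_diagonal_mul_sub_mul_diagonal_le (norm_nonneg ev)
      (fun _ => norm_le_pi_norm ev _) (fun _ => norm_le_pi_norm ev _) _).trans
      (by gcongr; exact hM.cols₂)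

end GradedBound

variable [DecidableEq c]

/-- Bounds for the blocks of the Ritz matrix: `s` for the deviation of the leading block from the
wanted eigenvalues and `t` for the off-diagonal blocks. -/
structure RitzBlockBound (ev : (a ⊕ b) ⊕ c → 𝕜) (M N : Matrix c (a ⊕ b) 𝕜) (t s : ℝ) :
    Prop where
  block₁₁ : ‖(ritzMatrix ev M N).toBlocks₁₁ - diagonal fun i => ev (Sum.inl (Sum.inl i))‖ ≤ s
  block₂₁ : ‖(ritzMatrix ev M N).toBlocks₂₁‖ ≤ t
  block₁₂ : ‖(ritzMatrix ev M N).toBlocks₁₂‖ ≤ t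

lemma RitzBlockBound.mono {ev : (a ⊕ b) ⊕ c → 𝕜} {M N : Matrix c (a ⊕ b) 𝕜} {t t' s s' : ℝ}
    (h : RitzBlockBound ev M N t s) (ht : t ≤ t') (hs : s ≤ s') :
    RitzBlockBound ev M N t' s' :=
  ⟨h.block₁₁.trans hs, h.block₂₁.trans ht, h.block₁₂.trans ht⟩

lemma exists_ritzBlockBound (ev : (a ⊕ b) ⊕ c → 𝕜) (M N : Matrix c (a ⊕ b) 𝕜) :
    ∃ K, RitzBlockBound ev M N K K :=
  ⟨max _ (max _ _), le_max_left _ _, (le_max_left _ _).trans (le_max_right _ _),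
    (le_max_right _ _).trans (le_max_right _ _)⟩

lemma GradedBound.ritzBlockBound (ev : (a ⊕ b) ⊕ c → 𝕜) {M N : Matrix c (a ⊕ b) 𝕜} {e d : ℝ}
    (hM : GradedBound M e d) (hN : GradedBound N e d) (hMN : ‖M‖ * ‖N‖ ≤ 1 / 2) :
    RitzBlockBound ev M N (4 * ‖ev‖ * (e * d)) (4 * ‖ev‖ * e ^ 2) := by
  have he := hM.nonneg_left
  set D := diagonal (ev ∘ Sum.inr) * M - M * diagonal (ev ∘ Sum.inl)
  have hD : GradedBound D (2 * ‖ev‖ * e) (2 * ‖ev‖ * d) := hM.diagonal_mul_sub_mul_diagonal ev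
  set T := Nᴴ * (1 + M * Nᴴ)⁻¹ * D
  have hT : ritzMatrix ev M N = diagonal (ev ∘ Sum.inl) + T :=
    eq_add_of_sub_eq' (ritzMatrix_sub_diagonal (isUnit_compression_one hMN) ev)
  have hT₁₁ : (ritzMatrix ev M N).toBlocks₁₁ - diagonal (fun i => ev (Sum.inl (Sum.inl i))) =
      T.toBlocks₁₁ := by
    ext; simp [hT, toBlocks₁₁, diagonal_apply]
  have hT₂₁ : (ritzMatrix ev M N).toBlocks₂₁ = T.toBlocks₂₁ := by
    ext; simp [hT, toBlocks₂₁]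
  have hT₁₂ : (ritzMatrix ev M N).toBlocks₁₂ = T.toBlocks₁₂ := by
    ext; simp [hT, toBlocks₁₂]
  constructor
  · calc _ = ‖T.toBlocks₁₁‖ := congrArg norm hT₁₁
      _ ≤ 2 * (‖N.toCols₁‖ * ‖D.toCols₁‖) := l2_opNorm_conjTranspose_mul_inv_mul_le hMN _ _
      _ ≤ 2 * (e * (2 * ‖ev‖ * e)) := by gcongr; exacts [hN.cols₁, hD.cols₁]
      _ = 4 * ‖ev‖ * e ^ 2 := by ring
  · calc _ = ‖T.toBlocks₂₁‖ := congrArg norm hT₂₁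
      _ ≤ 2 * (‖N.toCols₂‖ * ‖D.toCols₁‖) := l2_opNorm_conjTranspose_mul_inv_mul_le hMN _ _
      _ ≤ 2 * (d * (2 * ‖ev‖ * e)) := by
        gcongr
        exacts [hM.nonneg_right, hN.cols₂, hD.cols₁]
      _ = 4 * ‖ev‖ * (e * d) := by ring
  · calc _ = ‖T.toBlocks₁₂‖ := congrArg norm hT₁₂
      _ ≤ 2 * (‖N.toCols₁‖ * ‖D.toCols₂‖) := l2_opNorm_conjTranspose_mul_inv_mul_le hMN _ _
      _ ≤ 2 * (e * (2 * ‖ev‖ * d)) := by gcongr; exacts [hN.cols₁, hD.cols₂]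
      _ = 4 * ‖ev‖ * (e * d) := by ring

theorem eventually_ritzBlockBound (ev : (a ⊕ b) ⊕ c → 𝕜) :
    ∃ C, ∀ᶠ d in 𝓝 (0 : ℝ), ∀ e ≤ d, ∀ M N : Matrix c (a ⊕ b) 𝕜,
      GradedBound M e d → GradedBound N e d → RitzBlockBound ev M N (C * e) (C * e ^ 2) := by
  refine ⟨4 * ‖ev‖, (eventually_lt_nhds (show (0 : ℝ) < 1 / 4 by norm_num)).mono ?_⟩
  intro d hd e hed M N hM hN
  have he := hM.nonneg_left
  refine (hM.ritzBlockBound ev hN ?_).mono ?_ le_rfl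
  · exact (hM.norm_mul_norm_le hN hed).trans (by nlinarith [hM.nonneg_right])
  · gcongr
    exact mul_le_of_le_one_right he (by linarith)

end GradedPerturbation

section RitzPairs

variable {𝕜 : Type*} [RCLike 𝕜]

/-- `z` and `x` form an eigenpair of the pencil `(A, B)` up to a relative residual `δ`. -/
def IsApproxEigenpair {ι κ : Type*} [Fintype ι] [Fintype κ] (A B : Matrix ι κ 𝕜) (z : 𝕜)
    (x : κ → 𝕜) (δ : ℝ) : Prop :=
  ‖(A - z • B) *ᵥ x‖₂ ≤ δ * ‖x‖₂

lemma IsApproxEigenpair.mono {ι κ : Type*} [Fintype ι] [Fintype κ] {A B : Matrix ι κ 𝕜} {z : 𝕜}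
    {x : κ → 𝕜} {δ δ' : ℝ} (h : IsApproxEigenpair A B z x δ) (hδ : δ ≤ δ') :
    IsApproxEigenpair A B z x δ' :=
  h.trans (mul_le_mul_of_nonneg_right hδ (norm_nonneg _))

section Compression

variable {ι c κ : Type*} [Fintype ι] [Fintype c] [Fintype κ] [DecidableEq ι] [DecidableEq c]
  [DecidableEq κ] {ev : ι ⊕ c → 𝕜} {M N : Matrix c ι 𝕜}

/-- `z` and `g` form an eigenpair of the reduced pencil obtained by compressing
`(diagonal ev, 1)`; the corresponding Ritz vector is `graph M *ᵥ g`. -/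
structure IsRitzPair (ev : ι ⊕ c → 𝕜) (M N : Matrix c ι 𝕜) (z : 𝕜) (g : ι → 𝕜) : Prop where
  ne_zero : g ≠ 0
  eigen : compression ev M N *ᵥ g = z • (compression 1 M N *ᵥ g)

/-- The columns of `G` are a full set of eigenvectors of a regular reduced pencil, with
eigenvalues `r`. -/
structure IsRitzBasis (ev : ι ⊕ c → 𝕜) (M N : Matrix c ι 𝕜) (G : Matrix ι κ 𝕜) (r : κ → 𝕜) :
    Prop where
  isUnit : IsUnit (compression 1 M N)
  isInvertible : IsInvertible G
  eigen : compression ev M N * G = compression 1 M N * G * diagonal r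

namespace IsRitzBasis

variable {G : Matrix ι κ 𝕜} {r : κ → 𝕜}

lemma isRitzPair (h : IsRitzBasis ev M N G r) (k : κ) :
    IsRitzPair ev M N (r k) (G.col k) where
  ne_zero := h.isInvertible.col_ne_zero k
  eigen := by
    ext i
    have hik := congrFun (congrFun h.eigen i) k
    rw [mul_diagonal, mul_comm] at hik
    exact hik

lemma ritzMatrix_mul (h : IsRitzBasis ev M N G r) : ritzMatrix ev M N * G = G * diagonal r := by
  rw [ritzMatrix, Matrix.mul_assoc, h.eigen, Matrix.mul_assoc,
    nonsing_inv_mul_cancel_left _ _ ((isUnit_iff_isUnit_det _).mp h.isUnit)]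

lemma norm_ritzValue_le (h : IsRitzBasis ev M N G r) (k : κ) : ‖r k‖ ≤ ‖ritzMatrix ev M N‖ :=
  norm_eigenvalue_le_of_diagonalization h.isInvertible h.ritzMatrix_mul k

end IsRitzBasis

/-- Petrov–Galerkin orthogonality of the residual of the Ritz vector to `graph N`. -/
lemma IsRitzPair.galerkin {z : 𝕜} {g : ι → 𝕜} (h : IsRitzPair ev M N z g) :
    diagonal (fun i => ev (Sum.inl i) - z) *ᵥ g =
      -(Nᴴ *ᵥ (diagonal (fun j => ev (Sum.inr j) - z) *ᵥ (M *ᵥ g))) := by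
  have hres : compression (fun i => ev i - z) M N *ᵥ g = 0 := by
    have hd : diagonal (fun i => ev i - z) = diagonal ev - z • diagonal (1 : ι ⊕ c → 𝕜) := by
      rw [diagonal_one', smul_one_eq_diagonal, diagonal_sub]
    have hsplit : compression (fun i => ev i - z) M N =
        compression ev M N - z • compression 1 M N := by
      simp only [compression, hd, Matrix.mul_sub, Matrix.sub_mul, Matrix.mul_smul,
        Matrix.smul_mul]
    rw [hsplit, sub_mulVec, smul_mulVec, h.eigen, sub_self]
  rw [compression_eq, add_mulVec, ← mulVec_mulVec, ← mulVec_mulVec] at hres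
  exact eq_neg_of_add_eq_zero_left hres

/-- Restricting Galerkin orthogonality to the coordinates in the range of `f` controls the
components of `g` whose eigenvalues are at distance `x` from the Ritz value. -/
lemma IsRitzPair.mul_norm_comp_le {p : Type*} [Fintype p] [DecidableEq p] {z : 𝕜} {g : ι → 𝕜}
    {R x : ℝ} (h : IsRitzPair ev M N z g) (hR0 : 0 ≤ R) (hR : ∀ j, ‖ev (Sum.inr j) - z‖ ≤ R)
    (f : p → ι) (hx0 : 0 ≤ x) (hx : ∀ i, x ≤ ‖ev (Sum.inl (f i)) - z‖) :
    x * ‖g ∘ f‖₂ ≤ ‖N.submatrix id f‖ * (R * ‖M *ᵥ g‖₂) := by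
  set w := diagonal (fun j => ev (Sum.inr j) - z) *ᵥ (M *ᵥ g)
  have hw : ‖w‖₂ ≤ R * ‖M *ᵥ g‖₂ := l2_norm_diagonal_mulVec_le hR0 hR _
  have hrestrict : diagonal (fun i => ev (Sum.inl (f i)) - z) *ᵥ (g ∘ f) =
      -((N.submatrix id f)ᴴ *ᵥ w) := by
    ext i
    have hi := congrFun h.galerkin (f i)
    rw [mulVec_diagonal] at hi ⊢
    exact hi
  calc x * ‖g ∘ f‖₂ ≤ ‖-((N.submatrix id f)ᴴ *ᵥ w)‖₂ :=
        hrestrict ▸ mul_l2_norm_le_diagonal_mulVec hx0 hx (g ∘ f)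
    _ ≤ ‖N.submatrix id f‖ * ‖w‖₂ := by
        rw [WithLp.toLp_neg, norm_neg, ← l2_opNorm_conjTranspose (N.submatrix id f)]
        exact l2_norm_mulVec_le _ _
    _ ≤ ‖N.submatrix id f‖ * (R * ‖M *ᵥ g‖₂) := by gcongr

lemma IsRitzPair.isApproxEigenpair {z : 𝕜} {g : ι → 𝕜} {R x : ℝ} (h : IsRitzPair ev M N z g)
    (hR0 : 0 ≤ R) (hR : ∀ j, ‖ev (Sum.inr j) - z‖ ≤ R) (hN : ‖N‖ ≤ 1)
    (hx : ‖M *ᵥ g‖₂ ≤ x * ‖graph M *ᵥ g‖₂) :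
    IsApproxEigenpair (diagonal ev) 1 z (graph M *ᵥ g) (2 * R * x) := by
  set w := diagonal (fun j => ev (Sum.inr j) - z) *ᵥ (M *ᵥ g)
  have hw : ‖w‖₂ ≤ R * ‖M *ᵥ g‖₂ := l2_norm_diagonal_mulVec_le hR0 hR _
  have hres : (diagonal ev - z • 1) *ᵥ (graph M *ᵥ g) = fromRows (-Nᴴ) 1 *ᵥ w := by
    rw [smul_one_eq_diagonal, diagonal_sub, graph_mulVec, fromRows_mulVec, neg_mulVec,
      ← h.galerkin, one_mulVec]
    ext (i | j)
    · simp [mulVec_diagonal]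
    · simp only [w, mulVec_diagonal, Sum.elim_inr]
  have hrows : ‖fromRows (-Nᴴ) (1 : Matrix c c 𝕜)‖ ≤ 2 := by
    refine (l2_opNorm_fromRows_le _ _).trans ?_
    rw [norm_neg, l2_opNorm_conjTranspose]
    linarith [l2_opNorm_one_le (𝕜 := 𝕜) (ι := c)]
  calc _ = ‖fromRows (-Nᴴ) 1 *ᵥ w‖₂ := by rw [hres]
    _ ≤ 2 * (R * (x * ‖graph M *ᵥ g‖₂)) :=
        (l2_norm_mulVec_le _ _).trans (by gcongr; exact hw.trans (by gcongr))
    _ = 2 * R * x * ‖graph M *ᵥ g‖₂ := by ring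

end Compression

section GradedPerturbation

variable {a b c : Type*} [Fintype a] [Fintype b] [Fintype c]
  [DecidableEq a] [DecidableEq b] [DecidableEq c] {ev : (a ⊕ b) ⊕ c → 𝕜}
  {M N : Matrix c (a ⊕ b) 𝕜} {e d γ R : ℝ} {z : 𝕜} {g : a ⊕ b → 𝕜}

namespace IsRitzPair

variable (h : IsRitzPair ev M N z g) (hM : GradedBound M e d) (hN : GradedBound N e d)
  (hR0 : 0 ≤ R) (hR : ∀ j, ‖ev (Sum.inr j) - z‖ ≤ R)
  (hγ0 : 0 < γ) (hγ : ∀ i, γ ≤ ‖ev (Sum.inl (Sum.inr i)) - z‖) (hd : 2 * R * d ^ 2 ≤ γ)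

include h hM hN hR0 hR hγ0 hγ hd

lemma norm_mulVec_le : ‖M *ᵥ g‖₂ ≤ 2 * e * ‖g ∘ Sum.inl‖₂ := by
  have hd0 := hM.nonneg_right
  set u := ‖M *ᵥ g‖₂
  set x := ‖g ∘ Sum.inl‖₂
  set y := ‖g ∘ Sum.inr‖₂
  have hy : γ * y ≤ d * (R * u) :=
    (h.mul_norm_comp_le hR0 hR Sum.inr hγ0.le hγ).trans (by gcongr; exact hN.cols₂)
  have hu : u ≤ e * x + d * y := by
    calc u = ‖M.toCols₁ *ᵥ (g ∘ Sum.inl) + M.toCols₂ *ᵥ (g ∘ Sum.inr)‖₂ := by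
          rw [← fromCols_mulVec, fromCols_toCols]
      _ ≤ ‖M.toCols₁ *ᵥ (g ∘ Sum.inl)‖₂ + ‖M.toCols₂ *ᵥ (g ∘ Sum.inr)‖₂ :=
          norm_add_le (WithLp.toLp 2 _) (WithLp.toLp 2 _)
      _ ≤ ‖M.toCols₁‖ * x + ‖M.toCols₂‖ * y :=
          add_le_add (l2_norm_mulVec_le _ _) (l2_norm_mulVec_le _ _)
      _ ≤ e * x + d * y := by gcongr; exacts [hM.cols₁, hM.cols₂]
  have hhalf : γ * u ≤ γ * (2 * e * x) := by
    have hu0 : 0 ≤ u := norm_nonneg _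
    nlinarith [mul_le_mul_of_nonneg_left hu hγ0.le, mul_le_mul_of_nonneg_left hy hd0,
      mul_le_mul_of_nonneg_right hd hu0]
  exact le_of_mul_le_mul_left hhalf hγ0

lemma comp_inl_ne_zero : g ∘ Sum.inl ≠ 0 := by
  intro hzero
  have hMg : ‖M *ᵥ g‖₂ = 0 := by
    have hle := h.norm_mulVec_le hM hN hR0 hR hγ0 hγ hd
    rw [hzero, WithLp.toLp_zero, norm_zero, mul_zero] at hle
    exact le_antisymm hle (norm_nonneg _)
  have hinr : g ∘ Sum.inr = 0 := by
    have hle := h.mul_norm_comp_le hR0 hR Sum.inr hγ0.le hγ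
    rw [hMg, mul_zero, mul_zero] at hle
    simpa using nonpos_of_mul_nonpos_right hle hγ0
  refine h.ne_zero ?_
  rw [← Sum.elim_comp_inl_inr g, hzero, hinr, Sum.elim_zero_zero]

lemma norm_sub_le_of_nearest {i : a}
    (hi : ∀ j, ‖ev (Sum.inl (Sum.inl i)) - z‖ ≤ ‖ev (Sum.inl (Sum.inl j)) - z‖) :
    ‖z - ev (Sum.inl (Sum.inl i))‖ ≤ 2 * R * e ^ 2 := by
  have he := hM.nonneg_left
  have hpos : 0 < ‖g ∘ Sum.inl‖₂ := by
    simpa using h.comp_inl_ne_zero hM hN hR0 hR hγ0 hγ hd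
  rw [norm_sub_rev]
  refine le_of_mul_le_mul_right ?_ hpos
  calc _ ≤ ‖N.submatrix id Sum.inl‖ * (R * ‖M *ᵥ g‖₂) :=
        h.mul_norm_comp_le hR0 hR Sum.inl (norm_nonneg _) hi
    _ ≤ e * (R * (2 * e * ‖g ∘ Sum.inl‖₂)) := by
        gcongr
        exacts [hN.cols₁, h.norm_mulVec_le hM hN hR0 hR hγ0 hγ hd]
    _ = 2 * R * e ^ 2 * ‖g ∘ Sum.inl‖₂ := by ring

lemma isApproxEigenpair_of_gradedBound (hN1 : ‖N‖ ≤ 1) :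
    IsApproxEigenpair (diagonal ev) 1 z (graph M *ᵥ g) (4 * R * e) := by
  have he := hM.nonneg_left
  have hMg : ‖M *ᵥ g‖₂ ≤ 2 * e * ‖graph M *ᵥ g‖₂ := by
    refine (h.norm_mulVec_le hM hN hR0 hR hγ0 hγ hd).trans ?_
    have hsub : g ∘ Sum.inl = (graph M *ᵥ g) ∘ (Sum.inl ∘ Sum.inl) := by rw [graph_mulVec]; rfl
    rw [hsub]
    gcongr
    exact l2_norm_comp_le (Sum.inl_injective.comp Sum.inl_injective) _
  exact (h.isApproxEigenpair hR0 hR hN1 hMg).mono (by linarith)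

end IsRitzPair

/-- The eigenvalues `r` of the reduced pencil contain approximations of the wanted eigenvalues up
to `s`, such that the right and left Ritz pairs belonging to them have relative residuals at most
`t`. Left Ritz pairs are right Ritz pairs of the adjoint problem, in which `M` and `N` are
exchanged and all eigenvalues are conjugated. -/
def RitzPairBound (κ : Type*) [Fintype κ] [DecidableEq κ] (ev : (a ⊕ b) ⊕ c → 𝕜)
    (M N : Matrix c (a ⊕ b) 𝕜) (t s : ℝ) : Prop :=
  ∀ (G H : Matrix (a ⊕ b) κ 𝕜) (r : κ → 𝕜), IsRitzBasis ev M N G r →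
    IsRitzBasis (star ev) N M H (star r) → ∃ σ : a → κ, Function.Injective σ ∧ ∀ i,
      ‖r (σ i) - ev (Sum.inl (Sum.inl i))‖ ≤ s ∧
      IsApproxEigenpair (diagonal ev) 1 (r (σ i)) (graph M *ᵥ G.col (σ i)) t ∧
      IsApproxEigenpair (diagonal (star ev)) 1 (star (r (σ i))) (graph N *ᵥ H.col (σ i)) t

lemma RitzPairBound.mono {κ : Type*} [Fintype κ] [DecidableEq κ] {t t' s s' : ℝ}
    (h : RitzPairBound κ ev M N t s) (ht : t ≤ t') (hs : s ≤ s') :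
    RitzPairBound κ ev M N t' s' := by
  intro G H r hG hH
  obtain ⟨σ, hσ, hbound⟩ := h G H r hG hH
  exact ⟨σ, hσ, fun i => ⟨(hbound i).1.trans hs, (hbound i).2.1.mono ht, (hbound i).2.2.mono ht⟩⟩

lemma isApproxEigenpair_norm_add_norm {ι : Type*} [Fintype ι] [DecidableEq ι] (A : Matrix ι ι 𝕜)
    (z : 𝕜) (x : ι → 𝕜) : IsApproxEigenpair A 1 z x (‖A‖ + ‖z‖) := by
  refine (l2_norm_mulVec_le _ _).trans ?_
  gcongr
  refine (norm_sub_le _ _).trans ?_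
  rw [norm_smul]
  gcongr
  exact mul_le_of_le_one_right (norm_nonneg z) l2_opNorm_one_le

lemma exists_ritzPairBound (κ : Type*) [Fintype κ] [DecidableEq κ] (ev : (a ⊕ b) ⊕ c → 𝕜)
    (M N : Matrix c (a ⊕ b) 𝕜) : ∃ K, RitzPairBound κ ev M N K K := by
  refine ⟨‖ev‖ + ‖ritzMatrix ev M N‖, fun G _ r hG _ => ?_⟩
  obtain ⟨σ⟩ : Nonempty (a ⊕ b ≃ κ) := hG.isInvertible.nonempty_equiv
  have hr (k : κ) : ‖r k‖ ≤ ‖ritzMatrix ev M N‖ := hG.norm_ritzValue_le k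
  refine ⟨σ ∘ Sum.inl, σ.injective.comp Sum.inl_injective, fun i => ⟨?_, ?_, ?_⟩⟩
  · rw [add_comm]
    exact (norm_sub_le _ _).trans (add_le_add (hr _) (norm_le_pi_norm ev _))
  · refine (isApproxEigenpair_norm_add_norm _ _ _).mono (add_le_add ?_ (hr _))
    rw [l2_opNorm_diagonal]
  · refine (isApproxEigenpair_norm_add_norm _ _ _).mono (add_le_add ?_ ?_)
    · rw [l2_opNorm_diagonal, norm_star]
    · exact (norm_star _).trans_le (hr _)

lemma exists_pos_two_mul_lt_norm_sub {ι E : Type*} [Finite ι] [NormedAddCommGroup E]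
    (l : ι → E) : ∃ η > 0, ∀ i j, l i ≠ l j → 2 * η < ‖l i - l j‖ := by
  have hsmall : ∀ᶠ η in 𝓝 (0 : ℝ), ∀ i j, l i ≠ l j → 2 * η < ‖l i - l j‖ := by
    refine eventually_all.mpr fun i => eventually_all.mpr fun j =>
      eventually_imp_distrib_left.mpr fun hij => ?_
    exact (continuous_const_mul (2 : ℝ)).continuousAt.eventually_lt_const
      (by simpa [sub_eq_zero] using hij)
  obtain ⟨η, hη, hη0⟩ :=
    ((hsmall.filter_mono (nhdsWithin_le_nhds (s := Set.Ioi 0))).and self_mem_nhdsWithin).exists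
  exact ⟨η, hη0, hη⟩

lemma eventually_exists_ritzPair_matching (κ : Type*) [Fintype κ] [DecidableEq κ]
    (ev : (a ⊕ b) ⊕ c → 𝕜) {η : ℝ} (hη : 0 < η) :
    ∀ᶠ d in 𝓝 (0 : ℝ), ∀ e ≤ d, ∀ M N : Matrix c (a ⊕ b) 𝕜,
      GradedBound M e d → GradedBound N e d →
      ∀ (G : Matrix (a ⊕ b) κ 𝕜) (r : κ → 𝕜), IsRitzBasis ev M N G r →
        ∃ σ : a ⊕ b ≃ κ, ∀ i, ‖r (σ i) - ev (Sum.inl i)‖ < η := by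
  obtain ⟨τ, hτ, hmatch⟩ := Metric.eventually_nhds_iff.mp
    (eventually_exists_eigenvalue_matching (κ := κ) (ev ∘ Sum.inl) hη)
  have hsmall : ∀ᶠ d in 𝓝 (0 : ℝ), 4 * d ^ 2 < 1 / 2 ∧ 4 * ‖ev‖ * (4 * d ^ 2) < τ := by
    have hcont₁ : Continuous fun d : ℝ => 4 * d ^ 2 := by fun_prop
    have hcont₂ : Continuous fun d : ℝ => 4 * ‖ev‖ * (4 * d ^ 2) := by fun_prop
    exact (hcont₁.continuousAt.eventually_lt_const (by norm_num)).and
      (hcont₂.continuousAt.eventually_lt_const (by simpa using hτ))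
  refine hsmall.mono fun d ⟨hd, hdτ⟩ e hed M N hM hN G r hG => ?_
  have hMN : ‖M‖ * ‖N‖ ≤ 4 * d ^ 2 := hM.norm_mul_norm_le hN hed
  refine hmatch ?_ G r hG.isInvertible hG.ritzMatrix_mul
  calc dist (ritzMatrix ev M N) (diagonal (ev ∘ Sum.inl)) ≤ 4 * ‖ev‖ * (‖M‖ * ‖N‖) := by
        rw [dist_eq_norm]
        exact l2_opNorm_ritzMatrix_sub_diagonal_le (hMN.trans hd.le) ev
    _ ≤ 4 * ‖ev‖ * (4 * d ^ 2) := by gcongr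
    _ < τ := hdτ

theorem eventually_ritzPairBound (κ : Type*) [Fintype κ] [DecidableEq κ]
    (ev : (a ⊕ b) ⊕ c → 𝕜)
    (hsep : ∀ i j, ev (Sum.inl (Sum.inl i)) ≠ ev (Sum.inl (Sum.inr j))) :
    ∃ C, ∀ᶠ d in 𝓝 (0 : ℝ), ∀ e ≤ d, ∀ M N : Matrix c (a ⊕ b) 𝕜,
      GradedBound M e d → GradedBound N e d → RitzPairBound κ ev M N (C * e) (C * e ^ 2) := by
  obtain ⟨η, hη, hgap⟩ := exists_pos_two_mul_lt_norm_sub (ev ∘ Sum.inl)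
  set R := 2 * ‖ev‖ + η
  have hR0 : 0 ≤ R := by positivity
  have hsmall : ∀ᶠ d in 𝓝 (0 : ℝ), 2 * R * d ^ 2 < η ∧ d < 1 / 2 := by
    have hcont : Continuous fun d : ℝ => 2 * R * d ^ 2 := by fun_prop
    exact (hcont.continuousAt.eventually_lt_const (by simpa using hη)).and
      (eventually_lt_nhds (by norm_num))
  refine ⟨4 * R, ?_⟩
  filter_upwards [eventually_exists_ritzPair_matching κ ev hη, hsmall]
    with d hmatch ⟨hd, hd1⟩ e hed M N hM hN G H r hG hH
  obtain ⟨σ, hσ⟩ := hmatch e hed M N hM hN G r hG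
  refine ⟨σ ∘ Sum.inl, σ.injective.comp Sum.inl_injective, fun i => ?_⟩
  set k := σ (Sum.inl i)
  have hk : ‖r k - ev (Sum.inl (Sum.inl i))‖ < η := hσ (Sum.inl i)
  have hfar (x : a ⊕ b) (hx : ev (Sum.inl (Sum.inl i)) ≠ ev (Sum.inl x)) :
      η < ‖ev (Sum.inl x) - r k‖ := by
    have hik : 2 * η < ‖ev (Sum.inl (Sum.inl i)) - ev (Sum.inl x)‖ := hgap (Sum.inl i) x hx
    have htri := norm_sub_le_norm_sub_add_norm_sub (ev (Sum.inl (Sum.inl i))) (r k)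
      (ev (Sum.inl x))
    rw [norm_sub_rev (ev (Sum.inl (Sum.inl i))) (r k), norm_sub_rev (r k) (ev (Sum.inl x))] at htri
    linarith
  have hnearest (j : a) : ‖ev (Sum.inl (Sum.inl i)) - r k‖ ≤ ‖ev (Sum.inl (Sum.inl j)) - r k‖ := by
    by_cases hij : ev (Sum.inl (Sum.inl i)) = ev (Sum.inl (Sum.inl j))
    · rw [hij]
    · exact (norm_sub_rev _ _).trans_le (hk.le.trans (hfar _ hij).le)
  have hcR (j : c) : ‖ev (Sum.inr j) - r k‖ ≤ R := by
    have hrk : ‖r k‖ ≤ ‖ev‖ + η :=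
      (norm_le_norm_add_norm_sub' _ _).trans (add_le_add (norm_le_pi_norm ev _) hk.le)
    exact (norm_sub_le _ _).trans (by linarith [norm_le_pi_norm ev (Sum.inr j)])
  have hN1 : ‖N‖ ≤ 1 := by linarith [hN.norm_le]
  have hM1 : ‖M‖ ≤ 1 := by linarith [hM.norm_le]
  refine ⟨?_, ?_, ?_⟩
  · refine ((hG.isRitzPair k).norm_sub_le_of_nearest hM hN hR0 hcR hη
      (fun j => (hfar _ (hsep i j)).le) hd.le hnearest).trans ?_
    gcongr
    norm_num
  · exact (hG.isRitzPair k).isApproxEigenpair_of_gradedBound hM hN hR0 hcR hη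
      (fun j => (hfar _ (hsep i j)).le) hd.le hN1
  · refine (hH.isRitzPair k).isApproxEigenpair_of_gradedBound hN hM hR0 (fun j => ?_) hη
      (fun j => ?_) hd.le hM1
    · rw [Pi.star_apply, Pi.star_apply, ← star_sub, norm_star]
      exact hcR j
    · rw [Pi.star_apply, Pi.star_apply, ← star_sub, norm_star]
      exact (hfar _ (hsep i j)).le

end GradedPerturbation

end RitzPairs

section PowerIteration

variable {𝕜 : Type*} [RCLike 𝕜]

section Coupling

variable {ι c : Type*} [Fintype ι] [Fintype c] [DecidableEq ι] [DecidableEq c]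

/-- The matrix `Γ₂ᵏ E Γ₁⁻ᵏ`, where `Γ₁` and `Γ₂` are the diagonal blocks of `diagonal γ`. Its graph
is the image of `graph E` under the `k`-th power of `diagonal γ`. -/
def coupling (γ : ι ⊕ c → 𝕜) (E : Matrix c ι 𝕜) (k : ℕ) : Matrix c ι 𝕜 :=
  diagonal ((γ ∘ Sum.inr) ^ k) * E * diagonal ((γ ∘ Sum.inl)⁻¹ ^ k)

lemma coupling_zero (γ : ι ⊕ c → 𝕜) (E : Matrix c ι 𝕜) : coupling γ E 0 = E := by
  rw [coupling, pow_zero, pow_zero, diagonal_one', diagonal_one', Matrix.one_mul, Matrix.mul_one]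

lemma diagonal_mul_graph_coupling {γ : ι ⊕ c → 𝕜} (hγ : ∀ i, γ (Sum.inl i) ≠ 0)
    (E : Matrix c ι 𝕜) (k : ℕ) :
    diagonal γ * graph (coupling γ E k) =
      graph (coupling γ E (k + 1)) * diagonal (γ ∘ Sum.inl) := by
  ext (i | j) l
  · rw [diagonal_mul, mul_diagonal]
    simp only [graph, fromRows_apply_inl, one_apply, Function.comp_apply]
    split_ifs with hil <;> simp [hil]
  · have hl := hγ l
    simp only [graph, coupling, diagonal_mul, mul_diagonal, fromRows_apply_inr, Pi.pow_apply,
      Pi.inv_apply, Function.comp_apply, inv_pow]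
    field_simp
    ring

lemma l2_opNorm_coupling_le {γ : ι ⊕ c → 𝕜} {g g' : ℝ} (hg : 0 < g) (hg' : 0 ≤ g')
    (hι : ∀ i, g ≤ ‖γ (Sum.inl i)‖) (hc : ∀ j, ‖γ (Sum.inr j)‖ ≤ g') (E : Matrix c ι 𝕜) (k : ℕ) :
    ‖coupling γ E k‖ ≤ ‖E‖ * (g' / g) ^ k := by
  have hnum : ‖diagonal ((γ ∘ Sum.inr) ^ k)‖ ≤ g' ^ k :=
    l2_opNorm_diagonal_le (by positivity) fun j => by
      rw [Pi.pow_apply, norm_pow]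
      exact pow_le_pow_left₀ (norm_nonneg _) (hc j) k
  have hden : ‖diagonal ((γ ∘ Sum.inl)⁻¹ ^ k)‖ ≤ g⁻¹ ^ k :=
    l2_opNorm_diagonal_le (by positivity) fun i => by
      rw [Pi.pow_apply, norm_pow, Pi.inv_apply, norm_inv]
      exact pow_le_pow_left₀ (by positivity) (inv_anti₀ hg (hι i)) k
  calc ‖coupling γ E k‖ ≤ _ := l2_opNorm_mul_mul_le _ _ _
    _ ≤ g' ^ k * ‖E‖ * g⁻¹ ^ k := by gcongr
    _ = ‖E‖ * (g' / g) ^ k := by rw [div_eq_mul_inv, mul_pow]; ring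

end Coupling

variable {a b c : Type*}

/-- The values of `γ` fall into a wanted part `a`, a buffer `b` and a remainder `c`, separated
by `g₃ < g₂ ≤ g₁`. The wanted components converge at the rate `g₃ / g₁`, the buffer only at the
rate `g₃ / g₂`. -/
structure HasSpectralGap (γ : (a ⊕ b) ⊕ c → 𝕜) (g₁ g₂ g₃ : ℝ) : Prop where
  wanted : ∀ i, g₁ ≤ ‖γ (Sum.inl (Sum.inl i))‖
  buffer : ∀ i, g₂ ≤ ‖γ (Sum.inl (Sum.inr i))‖
  rest : ∀ j, ‖γ (Sum.inr j)‖ ≤ g₃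
  nonneg : 0 ≤ g₃
  lt : g₃ < g₂
  le : g₂ ≤ g₁

namespace HasSpectralGap

variable {γ : (a ⊕ b) ⊕ c → 𝕜} {g₁ g₂ g₃ : ℝ} (h : HasSpectralGap γ g₁ g₂ g₃)

include h

lemma pos₂ : 0 < g₂ := h.nonneg.trans_lt h.lt

lemma pos₁ : 0 < g₁ := h.pos₂.trans_le h.le

protected lemma star : HasSpectralGap (star γ) g₁ g₂ g₃ where
  wanted i := (h.wanted i).trans_eq (norm_star _).symm
  buffer i := (h.buffer i).trans_eq (norm_star _).symm
  rest j := (norm_star _).trans_le (h.rest j)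
  nonneg := h.nonneg
  lt := h.lt
  le := h.le

lemma ne_zero (i : a ⊕ b) : γ (Sum.inl i) ≠ 0 := by
  rw [← norm_pos_iff]
  obtain i | i := i
  exacts [h.pos₁.trans_le (h.wanted i), h.pos₂.trans_le (h.buffer i)]

variable [Fintype a] [Fintype b] [Fintype c] [DecidableEq a] [DecidableEq b] [DecidableEq c]

lemma gradedBound_coupling {E : Matrix c (a ⊕ b) 𝕜} {D : ℝ} (hE : GradedBound E D D) (k : ℕ) :
    GradedBound (coupling γ E k) (D * (g₃ / g₁) ^ k) (D * (g₃ / g₂) ^ k) := by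
  have hg₁ := h.pos₁.le
  have hg₂ := h.pos₂.le
  have hg₃ := h.nonneg
  constructor
  · have hcols : (coupling γ E k).toCols₁ = coupling (γ ∘ Sum.map Sum.inl id) E.toCols₁ k := by
      ext; simp [coupling]
    rw [hcols]
    refine (l2_opNorm_coupling_le (γ := γ ∘ Sum.map Sum.inl id) h.pos₁ hg₃ h.wanted h.rest _
      k).trans ?_
    gcongr
    exact hE.cols₁
  · have hcols : (coupling γ E k).toCols₂ = coupling (γ ∘ Sum.map Sum.inr id) E.toCols₂ k := by
      ext; simp [coupling]
    rw [hcols]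
    refine (l2_opNorm_coupling_le (γ := γ ∘ Sum.map Sum.inr id) h.pos₂ hg₃ h.buffer h.rest _
      k).trans ?_
    gcongr
    exact hE.cols₂

end HasSpectralGap

lemma exists_forall_of_eventually {P : ℕ → ℝ → Prop} (hmono : ∀ k, Monotone (P k))
    (hex : ∀ k, ∃ C, P k C) (hev : ∃ C, ∀ᶠ k in atTop, P k C) : ∃ C, ∀ k, P k C := by
  choose f hf using hex
  obtain ⟨C, hC⟩ := hev
  obtain ⟨m, hm⟩ := eventually_atTop.mp hC
  obtain ⟨C', hC'⟩ := ((Finset.range m).image f).exists_le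
  refine ⟨max C C', fun k => ?_⟩
  obtain hk | hk := le_or_gt m k
  · exact hmono k (le_max_left _ _) (hm k hk)
  · exact hmono k ((hC' _ (Finset.mem_image_of_mem f (Finset.mem_range.mpr hk))).trans
      (le_max_right _ _)) (hf k)

variable [Fintype a] [Fintype b] [Fintype c] [DecidableEq a] [DecidableEq b] [DecidableEq c]

/-- A bound which holds near the wanted subspace, where both couplings are small, holds along the
whole iteration, since only finitely many steps are not covered. If `g₃ = 0`, then the couplings
vanish from the first step on. -/
theorem HasSpectralGap.exists_forall_coupling {γ : (a ⊕ b) ⊕ c → 𝕜} {g₁ g₂ g₃ : ℝ}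
    (h : HasSpectralGap γ g₁ g₂ g₃)
    {P : Matrix c (a ⊕ b) 𝕜 → Matrix c (a ⊕ b) 𝕜 → ℝ → ℝ → Prop}
    (hmono : ∀ {M N t t' s s'}, P M N t s → t ≤ t' → s ≤ s' → P M N t' s')
    (hex : ∀ M N, ∃ K, P M N K K)
    (hev : ∃ C, ∀ᶠ d in 𝓝 (0 : ℝ), ∀ e ≤ d, ∀ M N,
      GradedBound M e d → GradedBound N e d → P M N (C * e) (C * e ^ 2))
    (E F : Matrix c (a ⊕ b) 𝕜) :
    ∃ C, ∀ k ≥ 1, P (coupling γ E k) (coupling (star γ) F k)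
      (C * (g₃ / g₁) ^ k) (C * ((g₃ / g₁) ^ k) ^ 2) := by
  obtain ⟨C, hC⟩ := hev
  set ε := g₃ / g₁
  set δ := g₃ / g₂
  have hε : 0 ≤ ε := div_nonneg h.nonneg h.pos₁.le
  have hεδ : ε ≤ δ := div_le_div_of_nonneg_left h.nonneg h.pos₂ h.le
  obtain ⟨D, hE, hF⟩ : ∃ D, GradedBound E D D ∧ GradedBound F D D := by
    obtain ⟨D, hD⟩ :=
      ({‖E.toCols₁‖, ‖E.toCols₂‖, ‖F.toCols₁‖, ‖F.toCols₂‖} : Finset ℝ).exists_le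
    exact ⟨D, ⟨hD _ (by simp), hD _ (by simp)⟩, ⟨hD _ (by simp), hD _ (by simp)⟩⟩
  have hD : 0 ≤ D := hE.nonneg_left
  set C' := max (C * D) (C * D ^ 2)
  have hbound (k : ℕ) (hk : ∀ e ≤ D * δ ^ k, ∀ M N, GradedBound M e (D * δ ^ k) →
      GradedBound N e (D * δ ^ k) → P M N (C * e) (C * e ^ 2)) :
      P (coupling γ E k) (coupling (star γ) F k) (C' * ε ^ k) (C' * (ε ^ k) ^ 2) := by
    refine hmono (hk (D * ε ^ k) (by gcongr) _ _ (h.gradedBound_coupling hE k)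
      (h.star.gradedBound_coupling hF k)) ?_ ?_
    · rw [← mul_assoc]
      gcongr
      exact le_max_left _ _
    · rw [mul_pow, ← mul_assoc]
      gcongr
      exact le_max_right _ _
  obtain hg₃ | hg₃ := h.nonneg.eq_or_lt
  · refine ⟨C', fun k hk => hbound k ?_⟩
    have hδ : D * δ ^ k = 0 := by simp [δ, ← hg₃, Nat.one_le_iff_ne_zero.mp hk]
    rw [hδ]
    exact hC.self_of_nhds
  · have hε0 : 0 < ε := div_pos hg₃ h.pos₁
    have hδ : Tendsto (fun k => D * δ ^ k) atTop (𝓝 0) := by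
      simpa using (tendsto_pow_atTop_nhds_zero_of_lt_one (hε.trans hεδ)
        ((div_lt_one h.pos₂).mpr h.lt)).const_mul D
    obtain ⟨C'', hC''⟩ := exists_forall_of_eventually
      (P := fun k C => P (coupling γ E k) (coupling (star γ) F k) (C * ε ^ k) (C * (ε ^ k) ^ 2))
      (fun k x y hxy hx => hmono hx (by gcongr) (by gcongr))
      (fun k => by
        obtain ⟨K, hK⟩ := hex (coupling γ E k) (coupling (star γ) F k)
        refine ⟨max (K / ε ^ k) (K / (ε ^ k) ^ 2), hmono hK ?_ ?_⟩ <;>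
          rw [← div_le_iff₀ (by positivity)]
        exacts [le_max_left _ _, le_max_right _ _])
      ⟨C', (hδ.eventually hC).mono hbound⟩
    exact ⟨C'', fun k _ => hC'' k⟩

end PowerIteration

section Eigendecomposition

variable {𝕜 ι κ : Type*} [RCLike 𝕜] [Fintype ι] [Fintype κ] [DecidableEq ι] [DecidableEq κ]

/-- The columns of `X` and `Y` are complete biorthogonal systems of right and left eigenvectors of
the pencil `(A, B)`, with eigenvalues `ev`. The index type `κ` may differ from `ι`, so that the
eigenvectors can be grouped. -/
structure IsEigendecomposition (A B : Matrix ι ι 𝕜) (X Y : Matrix ι κ 𝕜) (ev : κ → 𝕜) :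
    Prop where
  eigen : A * X = B * X * diagonal ev
  biorth : Yᴴ * B * X = 1
  complete : X * (Yᴴ * B) = 1

lemma isEigendecomposition_of_biorth {A B X Y : Matrix ι ι 𝕜} {ev : ι → 𝕜}
    (hX : A * X = B * X * diagonal ev) (hY : Yᴴ * B * X = 1) :
    IsEigendecomposition A B X Y ev :=
  ⟨hX, hY, mul_eq_one_comm.mp hY⟩

namespace IsEigendecomposition

variable {A B : Matrix ι ι 𝕜} {X Y : Matrix ι κ 𝕜} {ev : κ → 𝕜}
  (h : IsEigendecomposition A B X Y ev)

include h

lemma isInvertible : IsInvertible X := ⟨Yᴴ * B, h.complete, h.biorth⟩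

lemma mul_mul_conjTranspose : B * (X * Yᴴ) = 1 := by
  rw [mul_eq_one_comm, Matrix.mul_assoc, h.complete]

lemma isUnit : IsUnit B :=
  isUnit_iff_exists.mpr
    ⟨X * Yᴴ, h.mul_mul_conjTranspose, mul_eq_one_comm.mp h.mul_mul_conjTranspose⟩

lemma conjTranspose_mul_mul : Yᴴ * A * X = diagonal ev := by
  rw [Matrix.mul_assoc, h.eigen, ← Matrix.mul_assoc, ← Matrix.mul_assoc, h.biorth,
    Matrix.one_mul]

lemma inv_mul_mul : B⁻¹ * A * X = X * diagonal ev := by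
  rw [Matrix.mul_assoc, h.eigen, Matrix.mul_assoc,
    nonsing_inv_mul_cancel_left _ _ ((isUnit_iff_isUnit_det _).mp h.isUnit)]

lemma eq_mul {μ : Type*} (U : Matrix ι μ 𝕜) : U = X * (Yᴴ * B * U) := by
  rw [← Matrix.mul_assoc, h.complete, Matrix.one_mul]

protected lemma conjTranspose : IsEigendecomposition Aᴴ Bᴴ Y X (star ev) where
  eigen := by
    have hleft : Yᴴ * A = diagonal ev * (Yᴴ * B) := by
      rw [← h.conjTranspose_mul_mul, Matrix.mul_assoc (Yᴴ * A), h.complete, Matrix.mul_one]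
    simpa only [conjTranspose_mul, conjTranspose_conjTranspose, diagonal_conjTranspose] using
      congrArg Matrix.conjTranspose hleft
  biorth := by
    simpa only [conjTranspose_mul, conjTranspose_conjTranspose, conjTranspose_one,
      Matrix.mul_assoc] using congrArg Matrix.conjTranspose h.biorth
  complete := by
    simpa only [conjTranspose_mul, conjTranspose_conjTranspose, conjTranspose_one,
      Matrix.mul_assoc] using congrArg Matrix.conjTranspose h.mul_mul_conjTranspose

lemma submatrix {μ : Type*} [Fintype μ] [DecidableEq μ] (e : μ ≃ κ) :
    IsEigendecomposition A B (X.submatrix id e) (Y.submatrix id e) (ev ∘ e) where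
  eigen := by
    have hcols := congrArg (Matrix.submatrix · id e) h.eigen
    rwa [← submatrix_mul_equiv _ _ id e e, submatrix_diagonal_equiv] at hcols
  biorth := by
    have hrows := congrArg (Matrix.submatrix · e e) h.biorth
    rwa [submatrix_one_equiv] at hrows
  complete := by
    have hmul := congrArg (Matrix.submatrix · id id) h.complete
    rwa [← submatrix_mul_equiv _ _ id e id, submatrix_id_id] at hmul

lemma isApproxEigenpair_mulVec {z : 𝕜} {w : κ → 𝕜} {t : ℝ}
    (hw : IsApproxEigenpair (diagonal ev) 1 z w t) :
    IsApproxEigenpair A B z (X *ᵥ w) (‖B * X‖ * ‖Yᴴ * B‖ * t) := by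
  have hAB : (A - z • B) * X = B * X * (diagonal ev - z • 1) := by
    rw [Matrix.sub_mul, h.eigen, Matrix.mul_sub, Matrix.smul_mul, Matrix.mul_smul, Matrix.mul_one]
  have hinv : w = (Yᴴ * B) *ᵥ (X *ᵥ w) := by rw [mulVec_mulVec, h.biorth, one_mulVec]
  have ht : t * ‖w‖₂ ≤ ‖Yᴴ * B‖ * t * ‖X *ᵥ w‖₂ := by
    obtain rfl | hw0 := eq_or_ne w 0
    · simp
    · have ht0 : 0 ≤ t :=
        nonneg_of_mul_nonneg_left ((norm_nonneg _).trans hw) (by simpa using hw0)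
      calc t * ‖w‖₂ ≤ t * (‖Yᴴ * B‖ * ‖X *ᵥ w‖₂) := by
            gcongr
            nth_rw 1 [hinv]
            exact l2_norm_mulVec_le _ _
        _ = ‖Yᴴ * B‖ * t * ‖X *ᵥ w‖₂ := by ring
  calc _ = ‖(B * X) *ᵥ ((diagonal ev - z • 1) *ᵥ w)‖₂ := by
        rw [mulVec_mulVec, mulVec_mulVec, hAB]
    _ ≤ ‖B * X‖ * (t * ‖w‖₂) :=
        (l2_norm_mulVec_le _ _).trans (mul_le_mul_of_nonneg_left hw (norm_nonneg _))
    _ ≤ ‖B * X‖ * (‖Yᴴ * B‖ * t * ‖X *ᵥ w‖₂) := by gcongr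
    _ = _ := by ring

end IsEigendecomposition

end Eigendecomposition

section Filter

variable {n q : ℕ} {κ : Type*} [Fintype κ] [DecidableEq κ] {α β : Fin q → ℂ}
  {A B : Matrix (Fin n) (Fin n) ℂ} {X Y : Matrix (Fin n) κ ℂ} {ev : κ → ℂ}

lemma inv_mul_eq_of_mul_eq {𝕜 ι : Type*} [RCLike 𝕜] [Fintype ι] [DecidableEq ι]
    {K : Matrix ι ι 𝕜} {X : Matrix ι κ 𝕜} {d : κ → 𝕜} (hX : IsInvertible X)
    (h : K * X = X * diagonal d) (hd : ∀ j, d j ≠ 0) : K⁻¹ * X = X * diagonal d⁻¹ := by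
  obtain ⟨X', hXX', hX'X⟩ := hX
  have hinv : K * (X * diagonal d⁻¹ * X') = 1 := by
    have hdd : diagonal d * diagonal d⁻¹ = (1 : Matrix κ κ 𝕜) := by
      rw [diagonal_mul_diagonal, ← diagonal_one]
      exact congrArg diagonal (funext fun j => mul_inv_cancel₀ (hd j))
    rw [← Matrix.mul_assoc, ← Matrix.mul_assoc, h, Matrix.mul_assoc X, hdd, Matrix.mul_one, hXX']
  rw [inv_eq_right_inv hinv, Matrix.mul_assoc, hX'X, Matrix.mul_one]

lemma rhoMat_mul_eq_of_mul_eq {S : Matrix (Fin n) (Fin n) ℂ} (hX : IsInvertible X)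
    (h : S * X = X * diagonal ev) (hβ : ∀ l j, β l ≠ ev j) :
    rhoMat α β S * X = X * diagonal fun j => rho α β (ev j) := by
  have hterm (l : Fin q) : (β l • (1 : Matrix (Fin n) (Fin n) ℂ) - S)⁻¹ * X =
      X * diagonal fun j => (β l - ev j)⁻¹ := by
    refine inv_mul_eq_of_mul_eq hX ?_ fun j => sub_ne_zero.mpr (hβ l j)
    rw [Matrix.sub_mul, h, ← diagonal_sub, ← smul_one_eq_diagonal, Matrix.mul_sub,
      Matrix.smul_mul, Matrix.mul_smul, Matrix.one_mul, Matrix.mul_one]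
  rw [rhoMat, Matrix.sum_mul]
  simp only [Matrix.smul_mul, hterm]
  ext i j
  simp [rho, Matrix.sum_apply, mul_diagonal, Finset.mul_sum, div_eq_mul_inv, mul_left_comm]

namespace IsEigendecomposition

variable (h : IsEigendecomposition A B X Y ev)

include h

lemma rightProj_mul (hβ : ∀ l j, β l ≠ ev j) :
    rightProj α β A B * X = X * diagonal fun j => rho α β (ev j) :=
  rhoMat_mul_eq_of_mul_eq h.isInvertible h.inv_mul_mul hβ

lemma leftProj_mul (hβ : ∀ l j, β l ≠ ev j) :
    leftProj α β A B * Y = Y * diagonal (star fun j => rho α β (ev j)) := by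
  have hρ : rightProj α β A B = X * diagonal (fun j => rho α β (ev j)) * (Yᴴ * B) := by
    rw [← h.rightProj_mul hβ, Matrix.mul_assoc, h.complete, Matrix.mul_one]
  have hρ' : (rightProj α β A B)ᴴ * (Bᴴ * Y) =
      Bᴴ * Y * diagonal (star fun j => rho α β (ev j)) := by
    rw [hρ]
    simp only [conjTranspose_mul, conjTranspose_conjTranspose, diagonal_conjTranspose]
    rw [Matrix.mul_assoc, Matrix.mul_assoc _ Xᴴ, ← Matrix.mul_assoc Xᴴ, h.conjTranspose.biorth,
      Matrix.mul_one]
  rw [leftProj, ← rightProj, Matrix.mul_assoc, Matrix.mul_assoc, hρ', Matrix.mul_assoc,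
    nonsing_inv_mul_cancel_left _ _ ((isUnit_iff_isUnit_det _).mp h.conjTranspose.isUnit)]

end IsEigendecomposition

end Filter

section SubspaceIteration

variable {𝕜 ν ι c κ : Type*} [RCLike 𝕜] [Fintype ν] [Fintype ι] [Fintype c] [Fintype κ]
  [DecidableEq ι] [DecidableEq c] [DecidableEq κ]

omit [Fintype c] [DecidableEq c] in
lemma exists_eq_graph_mul {K : Matrix (ι ⊕ c) κ 𝕜} (hK : IsInvertible K.toRows₁) :
    ∃ E : Matrix c ι 𝕜, K = graph E * K.toRows₁ := by
  obtain ⟨S', -, hS'⟩ := hK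
  refine ⟨K.toRows₂ * S', ?_⟩
  rw [graph, fromRows_mul, Matrix.one_mul, Matrix.mul_assoc, hS', Matrix.mul_one, fromRows_toRows]

/-- Subspace iteration with the operator `R` moves the graph coordinates by powers of `R`,
regardless of the changes of basis `W k`. -/
lemma exists_mul_eq_graph_coupling_mul {R : Matrix ν ν 𝕜} {X : Matrix ν (ι ⊕ c) 𝕜}
    {γ : ι ⊕ c → 𝕜} (hR : R * X = X * diagonal γ) (hγ : ∀ i, γ (Sum.inl i) ≠ 0)
    {U : ℕ → Matrix ν κ 𝕜} {W : ℕ → Matrix κ κ 𝕜} (hU : ∀ k, U (k + 1) = R * U k * W (k + 1))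
    (hW : ∀ k, IsUnit (W (k + 1))) {E : Matrix c ι 𝕜} {S₀ : Matrix ι κ 𝕜}
    (hS₀ : IsInvertible S₀) (hU₀ : U 0 = X * (graph E * S₀)) (k : ℕ) :
    ∃ S : Matrix ι κ 𝕜, IsInvertible S ∧ R * U k = X * graph (coupling γ E (k + 1)) * S := by
  have hD : IsInvertible (diagonal (γ ∘ Sum.inl)) := by
    rw [isInvertible_iff_isUnit, isUnit_diagonal]
    exact Pi.isUnit_iff.mpr fun i => (hγ i).isUnit
  have hstep (k : ℕ) (S : Matrix ι κ 𝕜) : R * (X * graph (coupling γ E k) * S) =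
      X * graph (coupling γ E (k + 1)) * (diagonal (γ ∘ Sum.inl) * S) := by
    rw [Matrix.mul_assoc X, ← Matrix.mul_assoc, hR, Matrix.mul_assoc X,
      ← Matrix.mul_assoc (diagonal γ), diagonal_mul_graph_coupling hγ]
    simp only [Matrix.mul_assoc]
  induction k with
  | zero =>
    refine ⟨_, hD.mul hS₀, ?_⟩
    rw [hU₀, ← Matrix.mul_assoc X, ← hstep, coupling_zero]
  | succ k ih =>
    obtain ⟨S, hS, hRU⟩ := ih
    refine ⟨_, hD.mul (hS.mul (isInvertible_iff_isUnit.mpr (hW k))), ?_⟩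
    rw [hU, hRU, ← hstep, Matrix.mul_assoc _ S]

end SubspaceIteration

section ReducedProblem

variable {𝕜 ν ι c κ : Type*} [RCLike 𝕜] [Fintype ν] [Fintype ι] [Fintype c] [Fintype κ]
  [DecidableEq ι] [DecidableEq c] [DecidableEq κ] {ev : ι ⊕ c → 𝕜}
  {M N : Matrix c ι 𝕜} {S T : Matrix ι κ 𝕜}

omit [Fintype κ] [DecidableEq κ] in
lemma conjTranspose_graph_mul_mul_graph {A : Matrix ν ν 𝕜} {X Y : Matrix ν (ι ⊕ c) 𝕜}
    (h : Yᴴ * A * X = diagonal ev) :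
    (Y * graph N * T)ᴴ * A * (X * graph M * S) = Tᴴ * compression ev M N * S := by
  rw [compression, ← h]
  simp only [conjTranspose_mul, Matrix.mul_assoc]

lemma IsEigendecomposition.isRitzBasis {W Z : Matrix κ κ 𝕜} {r : κ → 𝕜} (hS : IsInvertible S)
    (hT : IsInvertible T) (h : IsEigendecomposition (Tᴴ * compression ev M N * S)
      (Tᴴ * compression 1 M N * S) W Z r) : IsRitzBasis ev M N (S * W) r := by
  obtain ⟨S', hSS', hS'S⟩ := id hS
  obtain ⟨T', hTT', hT'T⟩ := hT.conjTranspose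
  have hcancel (L : Matrix ι κ 𝕜) : T' * (Tᴴ * L) = L := by
    rw [← Matrix.mul_assoc, hT'T, Matrix.one_mul]
  refine ⟨?_, hS.mul h.isInvertible, ?_⟩
  · have hcompression : compression 1 M N = T' * (Tᴴ * compression 1 M N * S) * S' := by
      rw [Matrix.mul_assoc Tᴴ, hcancel, Matrix.mul_assoc, hSS', Matrix.mul_one]
    rw [hcompression, ← isInvertible_iff_isUnit]
    exact (IsInvertible.mul ⟨_, hT'T, hTT'⟩ (isInvertible_iff_isUnit.mpr h.isUnit)).mul
      ⟨_, hS'S, hSS'⟩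
  · rw [← hcancel (compression ev M N * (S * W)), ← hcancel (compression 1 M N * _ * _)]
    simpa only [Matrix.mul_assoc] using congrArg (T' * ·) h.eigen

lemma IsEigendecomposition.isRitzBasis_conjTranspose {W Z : Matrix κ κ 𝕜} {r : κ → 𝕜}
    (hS : IsInvertible S) (hT : IsInvertible T)
    (h : IsEigendecomposition (Tᴴ * compression ev M N * S) (Tᴴ * compression 1 M N * S) W Z r) :
    IsRitzBasis (star ev) N M (T * Z) (star r) := by
  have hadj (d : ι ⊕ c → 𝕜) :
      (Tᴴ * compression d M N * S)ᴴ = Sᴴ * compression (star d) N M * T := by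
    simp only [conjTranspose_mul, conjTranspose_conjTranspose, conjTranspose_compression,
      Matrix.mul_assoc]
  have h' := h.conjTranspose
  rw [hadj, hadj, star_one] at h'
  exact h'.isRitzBasis hT hS

lemma conj_inv_mul_eq_ritzMatrix {S' : Matrix κ ι 𝕜} (hSS' : S * S' = 1) (hS'S : S' * S = 1)
    (hT : IsInvertible T) (hunit : IsUnit (compression 1 M N)) :
    S * ((Tᴴ * compression 1 M N * S)⁻¹ * (Tᴴ * compression ev M N * S)) * S' =
      ritzMatrix ev M N := by
  set K := Tᴴ * compression 1 M N * S
  have hK : IsUnit K.det := by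
    rw [← isUnit_iff_isUnit_det, ← isInvertible_iff_isUnit]
    exact (hT.conjTranspose.mul (isInvertible_iff_isUnit.mpr hunit)).mul ⟨S', hSS', hS'S⟩
  have hsolve : Tᴴ * compression ev M N * S = K * (S' * ritzMatrix ev M N * S) := by
    have hritz : compression 1 M N * ritzMatrix ev M N = compression ev M N :=
      mul_nonsing_inv_cancel_left _ _ ((isUnit_iff_isUnit_det _).mp hunit)
    calc Tᴴ * compression ev M N * S
        = Tᴴ * compression 1 M N * (S * S') * ritzMatrix ev M N * S := by
          rw [hSS', Matrix.mul_one, Matrix.mul_assoc Tᴴ _ (ritzMatrix ev M N), hritz]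
      _ = K * (S' * ritzMatrix ev M N * S) := by simp only [K, Matrix.mul_assoc]
  rw [hsolve, nonsing_inv_mul_cancel_left _ _ hK, ← Matrix.mul_assoc, ← Matrix.mul_assoc, hSS',
    Matrix.one_mul, Matrix.mul_assoc, hSS', Matrix.mul_one]

end ReducedProblem

section Convergence

variable {n p q : ℕ} {α β : Fin q → ℂ} {A B : Matrix (Fin n) (Fin n) ℂ}
  {U₀ V₀ : Matrix (Fin n) (Fin p) ℂ} {U V : ℕ → Matrix (Fin n) (Fin p) ℂ}
  {W Z : ℕ → Matrix (Fin p) (Fin p) ℂ} {ritz : ℕ → Fin p → ℂ}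

lemma IsRun.isEigendecomposition (h : IsRun α β A B U₀ V₀ U V W Z ritz) (k : ℕ) :
    IsEigendecomposition (reduced α β A B A (U k) (V k)) (reduced α β A B B (U k) (V k))
      (W (k + 1)) (Z (k + 1)) (ritz (k + 1)) := by
  refine isEigendecomposition_of_biorth ?_ (h.biorth k)
  have hmul := congrArg (· * W (k + 1)) (h.solve k)
  simp only [Matrix.mul_assoc] at hmul
  rwa [← Matrix.mul_assoc _ _ (W (k + 1)), h.biorth, Matrix.mul_one, ← Matrix.mul_assoc] at hmul

variable {a b c : Type*} [Fintype a] [Fintype b] [Fintype c] [DecidableEq a] [DecidableEq b]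
  [DecidableEq c]

/-- The eigenvectors of `(A, B)`, grouped according to the size of `ρ` at their eigenvalues into
wanted ones, a buffer and a remainder, together with the condition that the starting subspaces are
in general position with respect to the wanted eigenvectors and the buffer. -/
structure IsSpectralSplitting (α β : Fin q → ℂ) (A B : Matrix (Fin n) (Fin n) ℂ)
    (U₀ V₀ : Matrix (Fin n) (Fin p) ℂ) (X Y : Matrix (Fin n) ((a ⊕ b) ⊕ c) ℂ)
    (ev : (a ⊕ b) ⊕ c → ℂ) (g₁ g₂ g₃ : ℝ) : Prop where
  eigendecomposition : IsEigendecomposition A B X Y ev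
  pole_ne : ∀ l j, β l ≠ ev j
  gap : HasSpectralGap (fun j => rho α β (ev j)) g₁ g₂ g₃
  isInvertible_right : IsInvertible (Yᴴ * B * U₀).toRows₁
  isInvertible_left : IsInvertible (Xᴴ * Bᴴ * V₀).toRows₁

namespace IsSpectralSplitting

variable {X Y : Matrix (Fin n) ((a ⊕ b) ⊕ c) ℂ} {ev : (a ⊕ b) ⊕ c → ℂ} {g₁ g₂ g₃ : ℝ}
  (h : IsSpectralSplitting α β A B U₀ V₀ X Y ev g₁ g₂ g₃)

include h

lemma exists_graph_coupling : ∃ E F : Matrix c (a ⊕ b) ℂ, ∀ {U V W Z ritz},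
    IsRun α β A B U₀ V₀ U V W Z ritz → ∀ k, ∃ S T : Matrix (a ⊕ b) (Fin p) ℂ,
      IsInvertible S ∧ IsInvertible T ∧
      rightProj α β A B * U k =
        X * graph (coupling (fun j => rho α β (ev j)) E (k + 1)) * S ∧
      leftProj α β A B * V k =
        Y * graph (coupling (star fun j => rho α β (ev j)) F (k + 1)) * T := by
  have hdec := h.eigendecomposition
  obtain ⟨E, hE⟩ := exists_eq_graph_mul h.isInvertible_right
  obtain ⟨F, hF⟩ := exists_eq_graph_mul h.isInvertible_left
  refine ⟨E, F, fun {U V W Z ritz} hrun k => ?_⟩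
  have hred := hrun.isEigendecomposition
  obtain ⟨S, hS, hUS⟩ := exists_mul_eq_graph_coupling_mul (hdec.rightProj_mul h.pole_ne)
    h.gap.ne_zero hrun.stepU (fun k => isInvertible_iff_isUnit.mp (hred k).isInvertible)
    h.isInvertible_right (by rw [← hE, hrun.initU]; exact hdec.eq_mul U₀) k
  obtain ⟨T, hT, hVT⟩ := exists_mul_eq_graph_coupling_mul (hdec.leftProj_mul h.pole_ne)
    h.gap.star.ne_zero hrun.stepV
    (fun k => isInvertible_iff_isUnit.mp (hred k).conjTranspose.isInvertible)
    h.isInvertible_left (by rw [← hF, hrun.initV]; exact hdec.conjTranspose.eq_mul V₀) k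
  exact ⟨S, T, hS, hT, hUS, hVT⟩

lemma reduced_eq {M N : Matrix c (a ⊕ b) ℂ} {S T : Matrix (a ⊕ b) (Fin p) ℂ}
    {U V : Matrix (Fin n) (Fin p) ℂ} (hU : rightProj α β A B * U = X * graph M * S)
    (hV : leftProj α β A B * V = Y * graph N * T) :
    reduced α β A B A U V = Tᴴ * compression ev M N * S ∧
      reduced α β A B B U V = Tᴴ * compression 1 M N * S := by
  rw [reduced, reduced, hU, hV]
  exact ⟨conjTranspose_graph_mul_mul_graph h.eigendecomposition.conjTranspose_mul_mul,
    conjTranspose_graph_mul_mul_graph (h.eigendecomposition.biorth.trans diagonal_one'.symm)⟩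

theorem exists_block_bound : ∃ C, ∀ {U V W Z ritz}, IsRun α β A B U₀ V₀ U V W Z ritz →
    ∀ k, ∃ (P : Matrix (Fin p) (a ⊕ b) ℂ) (Q : Matrix (a ⊕ b) (Fin p) ℂ)
      (K : Matrix (a ⊕ b) (a ⊕ b) ℂ), P * Q = 1 ∧ Q * P = 1 ∧
      K = Q * ((reduced α β A B B (U k) (V k))⁻¹ * reduced α β A B A (U k) (V k)) * P ∧
      ‖K.toBlocks₁₁ - diagonal fun i => ev (Sum.inl (Sum.inl i))‖ ≤
        C * (g₃ / g₁) ^ (2 * (k + 1)) ∧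
      ‖K.toBlocks₂₁‖ ≤ C * (g₃ / g₁) ^ (k + 1) ∧ ‖K.toBlocks₁₂‖ ≤ C * (g₃ / g₁) ^ (k + 1) := by
  obtain ⟨E, F, hEF⟩ := h.exists_graph_coupling
  obtain ⟨C, hC⟩ := h.gap.exists_forall_coupling (P := RitzBlockBound ev)
    RitzBlockBound.mono (exists_ritzBlockBound ev) (eventually_ritzBlockBound ev) E F
  refine ⟨C, fun {U V W Z ritz} hrun k => ?_⟩
  obtain ⟨S, T, ⟨S', hSS', hS'S⟩, hT, hU, hV⟩ := hEF hrun k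
  obtain ⟨hA, hB⟩ := h.reduced_eq hU hV
  have hred := hrun.isEigendecomposition k
  rw [hA, hB] at hred ⊢
  have hunit := (hred.isRitzBasis ⟨S', hSS', hS'S⟩ hT).isUnit
  have hbound := hC (k + 1) (Nat.le_add_left 1 k)
  refine ⟨S', S, _, hS'S, hSS', (conj_inv_mul_eq_ritzMatrix hSS' hS'S hT hunit).symm, ?_,
    hbound.block₂₁, hbound.block₁₂⟩
  rw [pow_mul']
  exact hbound.block₁₁

theorem exists_pair_bound
    (hsep : ∀ i j, ev (Sum.inl (Sum.inl i)) ≠ ev (Sum.inl (Sum.inr j))) :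
    ∃ C, ∀ {U V W Z ritz}, IsRun α β A B U₀ V₀ U V W Z ritz →
    ∀ k, ∃ σ : a → Fin p, Function.Injective σ ∧ ∀ i,
      ‖ritz (k + 1) (σ i) - ev (Sum.inl (Sum.inl i))‖ ≤ C * (g₃ / g₁) ^ (2 * (k + 1)) ∧
      IsApproxEigenpair A B (ritz (k + 1) (σ i)) ((U (k + 1)).col (σ i))
        (C * (g₃ / g₁) ^ (k + 1)) ∧
      IsApproxEigenpair Aᴴ Bᴴ (star (ritz (k + 1) (σ i))) ((V (k + 1)).col (σ i))
        (C * (g₃ / g₁) ^ (k + 1)) := by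
  obtain ⟨E, F, hEF⟩ := h.exists_graph_coupling
  obtain ⟨C, hC⟩ := h.gap.exists_forall_coupling (P := RitzPairBound (Fin p) ev)
    RitzPairBound.mono (exists_ritzPairBound (Fin p) ev)
    (eventually_ritzPairBound (Fin p) ev hsep) E F
  set κ := ‖B * X‖ * ‖Yᴴ * B‖
  refine ⟨max C (κ * C), fun {U V W Z ritz} hrun k => ?_⟩
  obtain ⟨S, T, hS, hT, hU, hV⟩ := hEF hrun k
  obtain ⟨hA, hB⟩ := h.reduced_eq hU hV
  have hred := hrun.isEigendecomposition k
  rw [hA, hB] at hred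
  obtain ⟨σ, hσ, hbound⟩ := hC (k + 1) (Nat.le_add_left 1 k) _ _ _ (hred.isRitzBasis hS hT)
    (hred.isRitzBasis_conjTranspose hS hT)
  have hε : 0 ≤ (g₃ / g₁) ^ (k + 1) := pow_nonneg (div_nonneg h.gap.nonneg h.gap.pos₁.le) _
  have hconst : κ * (C * (g₃ / g₁) ^ (k + 1)) ≤ max C (κ * C) * (g₃ / g₁) ^ (k + 1) := by
    rw [← mul_assoc]
    exact mul_le_mul_of_nonneg_right (le_max_right _ _) hε
  have hκ : ‖Bᴴ * Y‖ * ‖Xᴴ * Bᴴ‖ = κ := by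
    rw [← conjTranspose_mul, l2_opNorm_conjTranspose, ← l2_opNorm_conjTranspose (Bᴴ * Y),
      conjTranspose_mul, conjTranspose_conjTranspose, mul_comm]
  have hUX := hrun.stepU k
  have hVY := hrun.stepV k
  rw [hU, Matrix.mul_assoc, Matrix.mul_assoc] at hUX
  rw [hV, Matrix.mul_assoc, Matrix.mul_assoc] at hVY
  refine ⟨σ, hσ, fun i => ?_⟩
  rw [hUX, hVY, col_mul, col_mul, col_mul, col_mul]
  obtain ⟨hval, hright, hleft⟩ := hbound i
  refine ⟨?_, (h.eigendecomposition.isApproxEigenpair_mulVec hright).mono hconst,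
    (h.eigendecomposition.conjTranspose.isApproxEigenpair_mulVec hleft).mono (by rwa [hκ])⟩
  rw [pow_mul']
  exact hval.trans (mul_le_mul_of_nonneg_right (le_max_left _ _) (sq_nonneg _))

end IsSpectralSplitting

end Convergence

section Labelling

variable {n p : ℕ} {a b : Type*}

/-- The labelling of the first `p` indices together with the remaining ones that is obtained from
a labelling `e` of the first `p` indices. -/
def extendLabelling (hpn : p ≤ n) (e : a ⊕ b ≃ Fin p) : (a ⊕ b) ⊕ Fin (n - p) ≃ Fin n :=
  (Equiv.sumCongr e (Equiv.refl _)).trans (finSumFinEquiv.trans (finCongr (Nat.add_sub_of_le hpn)))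

lemma le_extendLabelling_inr (hpn : p ≤ n) (e : a ⊕ b ≃ Fin p) (i : Fin (n - p)) :
    p ≤ (extendLabelling hpn e (Sum.inr i) : ℕ) := by
  simp [extendLabelling]

lemma hasSpectralGap_extendLabelling {𝕜 : Type*} [RCLike 𝕜] {γ : Fin n → 𝕜}
    (hγ : Antitone fun j => ‖γ j‖) (hpn : p < n)
    (hgap : ‖γ ⟨p, hpn⟩‖ < ‖γ ⟨p - 1, by omega⟩‖) (e : a ⊕ b ≃ Fin p)
    {i₀ : Fin p} (he : ∀ i, ‖γ (Fin.castLE hpn.le i₀)‖ ≤ ‖γ (Fin.castLE hpn.le (e (Sum.inl i)))‖) :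
    HasSpectralGap (γ ∘ extendLabelling hpn.le e) ‖γ (Fin.castLE hpn.le i₀)‖ ‖γ ⟨p - 1, by omega⟩‖
      ‖γ ⟨p, hpn⟩‖ where
  wanted := he
  buffer i := hγ (Nat.le_sub_one_of_lt (e (Sum.inr i)).isLt)
  rest i := hγ (le_extendLabelling_inr hpn.le e i)
  nonneg := norm_nonneg _
  lt := hgap
  le := hγ (Nat.le_sub_one_of_lt i₀.isLt)

variable {q : ℕ} [Fintype a] [Fintype b] [DecidableEq a] [DecidableEq b] {α β : Fin q → ℂ}
  {A B X Y : Matrix (Fin n) (Fin n) ℂ} {U₀ V₀ : Matrix (Fin n) (Fin p) ℂ} {ev : Fin n → ℂ}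

lemma IsEigendecomposition.isSpectralSplitting (h : IsEigendecomposition A B X Y ev)
    (hβ : ∀ l j, β l ≠ ev j) (hγ : Antitone fun j => ‖rho α β (ev j)‖) (hpn : p < n)
    (hgap : ‖rho α β (ev ⟨p, hpn⟩)‖ < ‖rho α β (ev ⟨p - 1, by omega⟩)‖)
    (hU₀ : IsUnit ((firstCols hpn.le Y)ᴴ * B * U₀).det)
    (hV₀ : IsUnit (V₀ᴴ * B * firstCols hpn.le X).det) (e : a ⊕ b ≃ Fin p)
    {i₀ : Fin p} (he : ∀ i, ‖rho α β (ev (Fin.castLE hpn.le i₀))‖ ≤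
      ‖rho α β (ev (Fin.castLE hpn.le (e (Sum.inl i))))‖) :
    IsSpectralSplitting α β A B U₀ V₀ (X.submatrix id (extendLabelling hpn.le e))
      (Y.submatrix id (extendLabelling hpn.le e)) (ev ∘ extendLabelling hpn.le e)
      ‖rho α β (ev (Fin.castLE hpn.le i₀))‖ ‖rho α β (ev ⟨p - 1, by omega⟩)‖
      ‖rho α β (ev ⟨p, hpn⟩)‖ where
  eigendecomposition := h.submatrix _
  pole_ne l j := hβ l _
  gap := hasSpectralGap_extendLabelling (γ := fun j => rho α β (ev j)) hγ hpn hgap e he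
  isInvertible_right :=
    (isInvertible_iff_isUnit.mpr ((isUnit_iff_isUnit_det _).mpr hU₀)).submatrix e
  isInvertible_left := by
    have hV := (isInvertible_iff_isUnit.mpr ((isUnit_iff_isUnit_det _).mpr hV₀)).conjTranspose
    rw [conjTranspose_mul, conjTranspose_mul, conjTranspose_conjTranspose, ← Matrix.mul_assoc] at hV
    exact hV.submatrix e

end Labelling

end BiFEAST

open BiFEAST in
theorem mainTheorem4_general {n p m' q : ℕ}
    (A B X Y : Matrix (Fin n) (Fin n) ℂ) (ev : Fin n → ℂ)
    (hX : A * X = B * X * diagonal ev)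
    (hY : Yᴴ * B * X = 1)
    (α β : Fin q → ℂ) (hβ : ∀ l j, β l ≠ ev j)
    (hγ : ∀ i j : Fin n, i ≤ j → ‖rho α β (ev j)‖ ≤ ‖rho α β (ev i)‖)
    (hm : 0 < m') (hmp : m' ≤ p) (hpn : p < n)
    (hgap_p : ∀ i j : Fin n, (i : ℕ) < p → p ≤ (j : ℕ) →
      ‖rho α β (ev j)‖ < ‖rho α β (ev i)‖)
    (U₀ V₀ : Matrix (Fin n) (Fin p) ℂ)
    (hU₀ : IsUnit ((firstCols hpn.le Y)ᴴ * B * U₀).det)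
    (hV₀ : IsUnit (V₀ᴴ * B * firstCols hpn.le X).det)
    (ε : ℝ)
    (hε : ε = ‖rho α β (ev ⟨p, hpn⟩) /
      rho α β (ev ⟨m' - 1, (m'.sub_le 1).trans_lt (hmp.trans_lt hpn)⟩)‖) :
    ∃ C : ℝ, ∀ (U V : ℕ → Matrix (Fin n) (Fin p) ℂ) (W Z : ℕ → Matrix (Fin p) (Fin p) ℂ)
      (ritz : ℕ → Fin p → ℂ), IsRun α β A B U₀ V₀ U V W Z ritz →
      ∀ k : ℕ, 1 ≤ k →
        (∃ (A₁₁ : Matrix (Fin m') (Fin m') ℂ) (A₁₂ : Matrix (Fin m') (Fin (p - m')) ℂ)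
            (A₂₁ : Matrix (Fin (p - m')) (Fin m') ℂ)
            (A₂₂ : Matrix (Fin (p - m')) (Fin (p - m')) ℂ)
            (P : Matrix (Fin p) (Fin m' ⊕ Fin (p - m')) ℂ)
            (Q : Matrix (Fin m' ⊕ Fin (p - m')) (Fin p) ℂ),
          P * Q = 1 ∧ Q * P = 1 ∧
          fromBlocks A₁₁ A₁₂ A₂₁ A₂₂ =
            Q * ((reduced α β A B B (U (k - 1)) (V (k - 1)))⁻¹ *
              reduced α β A B A (U (k - 1)) (V (k - 1))) * P ∧
          ‖A₁₁ - diagonal (fun j : Fin m' => ev (Fin.castLE (hmp.trans hpn.le) j))‖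
            ≤ C * ε ^ (2 * k) ∧
          ‖A₂₁‖ ≤ C * ε ^ k ∧ ‖A₁₂‖ ≤ C * ε ^ k) ∧
        (∃ s : Fin m' → Fin p, Function.Injective s ∧ ∀ j : Fin m',
          ‖ritz k (s j) - ev (Fin.castLE (hmp.trans hpn.le) j)‖ ≤ C * ε ^ (2 * k) ∧
          enorm2 ((A - ritz k (s j) • B) *ᵥ (U k).col (s j))
            ≤ C * ε ^ k * enorm2 ((U k).col (s j)) ∧
          enorm2 ((A - ritz k (s j) • B)ᴴ *ᵥ (V k).col (s j))
            ≤ C * ε ^ k * enorm2 ((V k).col (s j))) := by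
  have hsplit {a b : Type} [Fintype a] [Fintype b] [DecidableEq a] [DecidableEq b] :=
    (isEigendecomposition_of_biorth hX hY).isSpectralSplitting (a := a) (b := b) hβ
      (fun i j hij => hγ i j hij) hpn
      (hgap_p _ _ (Nat.sub_one_lt_of_lt (hm.trans_le hmp)) le_rfl) hU₀ hV₀
  let i₀ : Fin p := ⟨m' - 1, (Nat.sub_one_lt hm.ne').trans_le hmp⟩
  let IsWanted (i : Fin p) :=
    ‖rho α β (ev (Fin.castLE hpn.le i₀))‖ ≤ ‖rho α β (ev (Fin.castLE hpn.le i))‖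
  have hwanted (i : Fin m') : IsWanted (Fin.castLE hmp i) := hγ _ _ (Nat.le_sub_one_of_lt i.isLt)
  obtain ⟨C₁, hC₁⟩ := (hsplit (finSumFinEquiv.trans (finCongr (Nat.add_sub_of_le hmp)))
    (i₀ := i₀) hwanted).exists_block_bound
  -- The wanted eigenvalues must differ from the others, which only the set of all indices with
  -- `|γ_{m'}| ≤ |γ i|` guarantees.
  obtain ⟨C₂, hC₂⟩ := (hsplit (Equiv.sumCompl IsWanted) (i₀ := i₀) fun i => i.2).exists_pair_bound
    fun i j hij => j.2 (i.2.trans_eq (congrArg (fun z => ‖rho α β z‖) hij))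
  rw [norm_div] at hε
  have hε0 : 0 ≤ ε := hε ▸ by positivity
  have hmax₁ (l : ℕ) : C₁ * ε ^ l ≤ max C₁ C₂ * ε ^ l := by gcongr; exact le_max_left _ _
  have hmax₂ (l : ℕ) : C₂ * ε ^ l ≤ max C₁ C₂ * ε ^ l := by gcongr; exact le_max_right _ _
  refine ⟨max C₁ C₂, fun U V W Z ritz hrun k hk => ?_⟩
  obtain ⟨k, rfl⟩ := Nat.exists_eq_add_of_le' hk
  obtain ⟨P, Q, K, hPQ, hQP, hK, h₁₁, h₂₁, h₁₂⟩ := hε ▸ hC₁ hrun k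
  obtain ⟨σ, hσ, hpair⟩ := hε ▸ hC₂ hrun k
  refine ⟨⟨_, _, _, _, P, Q, hPQ, hQP, (fromBlocks_toBlocks K).trans hK, h₁₁.trans (hmax₁ _),
    h₂₁.trans (hmax₁ _), h₁₂.trans (hmax₁ _)⟩, fun i => σ ⟨_, hwanted i⟩,
    hσ.comp fun i j hij => by simpa using hij, fun i => ?_⟩
  obtain ⟨hval, hright, hleft⟩ := hpair ⟨_, hwanted i⟩
  rw [conjTranspose_sub, conjTranspose_smul]
  exact ⟨hval.trans (hmax₂ _), hright.mono (hmax₂ _), hleft.mono (hmax₂ _)⟩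

theorem mainTheorem4 {n p m' q : ℕ}
    (A B X Y : Matrix (Fin n) (Fin n) ℂ) (ev : Fin n → ℂ)
    (hB : IsUnit B.det)
    -- eigendecomposition with bi-orthogonal right and left eigenvectors
    (hX : A * X = B * X * Matrix.diagonal ev)
    (hY : Y.conjTranspose * B * X = 1)
    -- the rational function; no pole is an eigenvalue
    (α β : Fin q → ℂ) (hβ : ∀ l j, β l ≠ ev j)
    -- numbering with `|γ₁| ≥ ... ≥ |γₙ|`, where `γⱼ = ρ(λⱼ)`
    (hγ : ∀ i j : Fin n, i ≤ j → ‖BiFEAST.rho α β (ev j)‖ ≤ ‖BiFEAST.rho α β (ev i)‖)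
    (hm : 0 < m') (hmp : m' ≤ p) (hpn : p < n)
    -- `|γⱼ| < |γᵢ|` for `i ≤ m' < j`, and for `i ≤ p < j`
    (hgap_m : ∀ i j : Fin n, (i : ℕ) < m' → m' ≤ (j : ℕ) →
      ‖BiFEAST.rho α β (ev j)‖ < ‖BiFEAST.rho α β (ev i)‖)
    (hgap_p : ∀ i j : Fin n, (i : ℕ) < p → p ≤ (j : ℕ) →
      ‖BiFEAST.rho α β (ev j)‖ < ‖BiFEAST.rho α β (ev i)‖)
    -- the starting matrices
    (U₀ V₀ : Matrix (Fin n) (Fin p) ℂ)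
    (hUV : V₀.conjTranspose * B * U₀ = 1)
    (hU₀ : IsUnit ((BiFEAST.firstCols hpn.le Y).conjTranspose * B * U₀).det)
    (hV₀ : IsUnit (V₀.conjTranspose * B * BiFEAST.firstCols hpn.le X).det)
    -- `ε = |γ_{p+1} / γ_{m'}|`
    (ε : ℝ)
    (hε : ε = ‖BiFEAST.rho α β (ev ⟨p, hpn⟩) /
      BiFEAST.rho α β (ev ⟨m' - 1, by omega⟩)‖) :
    ∃ C : ℝ, ∀ (U V : ℕ → Matrix (Fin n) (Fin p) ℂ) (W Z : ℕ → Matrix (Fin p) (Fin p) ℂ)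
      (ritz : ℕ → Fin p → ℂ), BiFEAST.IsRun α β A B U₀ V₀ U V W Z ritz →
      ∀ k : ℕ, 1 ≤ k →
        -- `B̂⁻¹Â` of step `k` is similar to a matrix of the asserted block form
        (∃ (A₁₁ : Matrix (Fin m') (Fin m') ℂ) (A₁₂ : Matrix (Fin m') (Fin (p - m')) ℂ)
            (A₂₁ : Matrix (Fin (p - m')) (Fin m') ℂ)
            (A₂₂ : Matrix (Fin (p - m')) (Fin (p - m')) ℂ)
            (P : Matrix (Fin p) (Fin m' ⊕ Fin (p - m')) ℂ)
            (Q : Matrix (Fin m' ⊕ Fin (p - m')) (Fin p) ℂ),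
          P * Q = 1 ∧ Q * P = 1 ∧
          Matrix.fromBlocks A₁₁ A₁₂ A₂₁ A₂₂ =
            Q * ((BiFEAST.reduced α β A B B (U (k - 1)) (V (k - 1)))⁻¹ *
              BiFEAST.reduced α β A B A (U (k - 1)) (V (k - 1))) * P ∧
          ‖A₁₁ - Matrix.diagonal (fun j : Fin m' => ev (Fin.castLE (hmp.trans hpn.le) j))‖
            ≤ C * ε ^ (2 * k) ∧
          ‖A₂₁‖ ≤ C * ε ^ k ∧ ‖A₁₂‖ ≤ C * ε ^ k) ∧
        -- `m'` of the computed eigenvalues, with their columns of `U k` and `V k`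
        (∃ s : Fin m' → Fin p, Function.Injective s ∧ ∀ j : Fin m',
          ‖ritz k (s j) - ev (Fin.castLE (hmp.trans hpn.le) j)‖ ≤ C * ε ^ (2 * k) ∧
          BiFEAST.enorm2 ((A - ritz k (s j) • B).mulVec ((U k).col (s j)))
            ≤ C * ε ^ k * BiFEAST.enorm2 ((U k).col (s j)) ∧
          BiFEAST.enorm2 ((A - ritz k (s j) • B).conjTranspose.mulVec ((V k).col (s j)))
            ≤ C * ε ^ k * BiFEAST.enorm2 ((V k).col (s j)))  :=
  mainTheorem4_general A B X Y ev hX hY α β hβ hγ hm hmp hpn hgap_p U₀ V₀ hU₀ hV₀ ε hε
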